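/- Let $\lambda,\theta,\gamma,\delta>0$, $\alpha>2$, $p\in[0,1]$, and put $b=2/\alpha$, $\iota=\sqrt{-1}$. A typical node $X_0$ sits at the origin of the plane; the other nodes $X_1,X_2,\dots$ form a homogeneous Poisson point process of intensity $\lambda$. The fading (power) gains $G_i$ of the links between $X_i$ and $X_0$ are i.i.d. exponential with mean $1$ (Rayleigh fading), independent of the positions; the channel gain is $G_i|X_i|^{-\alpha}$, and $X_i$ is a neighbor of $X_0$ if $G_i|X_i|^{-\alpha}\ge\theta$. Positions and fading gains stay fixed during the broadcast period. In each frame every node (including $X_0$) transmits with probability $p$, independently over nodes and frames and of positions and fading. In a given frame $X_0$ receives the message of $X_i$ if $X_i$ transmits, $X_0$ does not transmit, and $$\frac{\gamma\,G_i|X_i|^{-\alpha}}{1+\gamma\sum_{j\ne i,\ X_j\text{ transmits}}G_j|X_j|^{-\alpha}}\ \ge\ \delta .$$ A frame carries $L\ge 1$ bits and consists of at least $L/\log_2(1+\delta)$ symbols; $M_f$ is a number of frames that fit into $M_a$ symbol transmissions. Let $\mathsf P_e^{a}$ be the probability that $X_0$ receives the message of a given neighbor in none of the $M_f$ frames, where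 the given neighbor is a typical (Palm-distributed) one, that is, $$\mathsf P_e^{a}=\frac{\mathbb E\big[\#\{\text{neighbors of }X_0\text{ whose message is received in none of the }M_f\text{ frames}\}\big]}{\mathbb E\big[\#\{\text{neighbors of }X_0\}\big]} .$$ Then, with $n_a=M_a\log_2(1+\delta)/L$, $$\mathsf P_e^{a}\ \ge\ \Bigg(\max\Bigg\{0,\,1-\frac1\pi\,p(1-p)\Big(\frac\theta\delta\Big)^{b}\sin\Big(\frac{b\pi}2\Big)\Gamma(1-b)\int_{-\infty}^{\infty}|\omega|^{b-1}\exp\Big\{-\lambda p\,\frac{b\pi^2}{\sin(b\pi)}(\iota\omega)^b-\iota\frac{\omega}{\gamma}\Big\}\,d\omega\Bigg\}\Bigg)^{n_a},$$ where $(\iota\omega)^b$ is the principal power; for $p>0$ the integral converges absolutely and its value is real (for $p=0$ the term containing it is $0$). -/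

import Mathlib

open MeasureTheory ProbabilityTheory
open scoped ENNReal

noncomputable section

/-- The random measure `N` is a Poisson point process with intensity measure `μ`: the number of
points in a measurable set `B` of finite intensity is Poisson with mean `μ B`, and the numbers of
points in pairwise disjoint such sets are independent. -/
structure IsPoissonPP {Ω E : Type*} [MeasurableSpace Ω] [MeasurableSpace E]
    (N : Ω → Measure E) (μ : Measure E) (P : Measure Ω) : Prop where
  count_law : ∀ B : Set E, MeasurableSet B → μ B ≠ ∞ →
    HasLaw (fun ω => N ω B)
      ((poissonMeasure (μ B).toNNReal).map (fun k : ℕ => (k : ℝ≥0∞))) P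
  count_indep : ∀ (n : ℕ) (B : Fin n → Set E), (∀ k, MeasurableSet (B k)) →
    (∀ k, μ (B k) ≠ ∞) → (∀ j k, j ≠ k → Disjoint (B j) (B k)) →
    iIndepFun (fun k ω => N ω (B k)) P

/-- The random data of the network as seen from the typical node, which sits at the origin. The
other nodes are enumerated by `ℕ` (there are almost surely infinitely many of them). -/
structure Network (Ω : Type*) where
  /-- position of each other node in the plane -/
  pos : ℕ → Ω → EuclideanSpace ℝ (Fin 2)
  /-- small-scale fading (power) gain of the link between each other node and the typical node -/
  fade : ℕ → Ω → ℝ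
  /-- `tx v m ω = true` if node `v` transmits in frame `m`; `none` is the typical node, and
  `some i` is the `i`-th other node -/
  tx : Option ℕ → ℕ → Ω → Bool

namespace Network

variable {Ω : Type*}

/-- The point process formed by the positions of the nodes other than the typical one. -/
def nodeMeasure (W : Network Ω) (ω : Ω) : Measure (EuclideanSpace ℝ (Fin 2)) :=
  Measure.sum fun i => Measure.dirac (W.pos i ω)

/-- Poisson network of intensity `lam` with independent Rayleigh fading (that is, the power gains
are exponential with mean one) and slotted ALOHA with transmit probability `p`: in each frame, each
node transmits with probability `p`, independently of everything else. -/
structure IsPoissonAloha [MeasurableSpace Ω] (W : Network Ω) (P : Measure Ω) (lam p : ℝ) :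
    Prop where
  measurable_pos : ∀ i, Measurable (W.pos i)
  measurable_fade : ∀ i, Measurable (W.fade i)
  measurable_tx : ∀ v m, Measurable (W.tx v m)
  poisson : IsPoissonPP W.nodeMeasure (ENNReal.ofReal lam • volume) P
  fade_law : ∀ i, HasLaw (W.fade i) (expMeasure 1) P
  tx_law : ∀ v m, P {ω | W.tx v m ω = true} = ENNReal.ofReal p
  indep_fade : iIndepFun W.fade P
  indep_tx : iIndepFun (fun (vm : Option ℕ × ℕ) ω => W.tx vm.1 vm.2 ω) P
  indep_pos_fade : IndepFun (fun ω i => W.pos i ω) (fun ω i => W.fade i ω) P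
  indep_pos_fade_tx : IndepFun (fun ω => ((fun i => W.pos i ω), (fun i => W.fade i ω)))
    (fun ω (vm : Option ℕ × ℕ) => W.tx vm.1 vm.2 ω) P

/-- Channel gain of the link between node `i` and the typical node, path-loss exponent `α`. -/
def gain (W : Network Ω) (α : ℝ) (i : ℕ) (ω : Ω) : ℝ :=
  W.fade i ω * ‖W.pos i ω‖ ^ (-α)

/-- Node `i` is a neighbor of the typical node. -/
def IsNeighbor (W : Network Ω) (α θ : ℝ) (i : ℕ) (ω : Ω) : Prop :=
  θ ≤ W.gain α i ω

open Classical in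
/-- Interference at the typical node in frame `m`, for the reception from node `i`: total gain of
all the other nodes that transmit in that frame. -/
def interference (W : Network Ω) (α : ℝ) (i m : ℕ) (ω : Ω) : ℝ≥0∞ :=
  ∑' j : ℕ, if j ≠ i ∧ W.tx (some j) m ω = true then ENNReal.ofReal (W.gain α j ω) else 0

/-- Signal-to-interference-plus-noise ratio at the typical node in frame `m` for the signal of node
`i`, at nominal signal-to-noise ratio `γ`. -/
def sinr (W : Network Ω) (α γ : ℝ) (i m : ℕ) (ω : Ω) : ℝ≥0∞ :=
  ENNReal.ofReal (γ * W.gain α i ω) / (ENNReal.ofReal γ * W.interference α i m ω + 1)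

/-- In frame `m` the typical node receives the message of node `i`: node `i` transmits, the typical
node listens, and the SINR is no smaller than the threshold `δ`. -/
def Receives (W : Network Ω) (α γ δ : ℝ) (i m : ℕ) (ω : Ω) : Prop :=
  W.tx (some i) m ω = true ∧ W.tx none m ω = false ∧ ENNReal.ofReal δ ≤ W.sinr α γ i m ω

/-- The typical node has not received the message of node `i` in any of the first `Mf` frames. -/
def Fails (W : Network Ω) (α γ δ : ℝ) (Mf i : ℕ) (ω : Ω) : Prop :=
  ∀ m < Mf, ¬ W.Receives α γ δ i m ω

/-- The probability that the typical node fails, in `Mf` frames, to receive the message of a given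
neighbor. The given neighbor is distributed according to the Palm distribution, i.e. this is the
expected number of neighbors whose message is missed over the expected number of neighbors. -/
def errorProb [MeasurableSpace Ω] (W : Network Ω) (P : Measure Ω) (α θ γ δ : ℝ) (Mf : ℕ) : ℝ :=
  ((∫⁻ ω, ((Set.encard {i | W.IsNeighbor α θ i ω ∧ W.Fails α γ δ Mf i ω} : ℕ∞) : ℝ≥0∞) ∂P) /
    (∫⁻ ω, ((Set.encard {i | W.IsNeighbor α θ i ω} : ℕ∞) : ℝ≥0∞) ∂P)).toReal

end Network

/-- The integrand `|ω|^{b-1} exp(-λ p (b π² / sin (b π)) (ι ω)^b - ι ω / γ)`. -/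
def alohaIntegrand (lam p γ b : ℝ) (w : ℝ) : ℂ :=
  ((|w| ^ (b - 1) : ℝ) : ℂ) *
    Complex.exp (-((lam * p * (b * Real.pi ^ 2 / Real.sin (b * Real.pi)) : ℝ) : ℂ) *
      (Complex.I * (w : ℂ)) ^ (b : ℂ) - Complex.I * ((w / γ : ℝ) : ℂ))

end

/-!
Conditionally on positions and fading gains, the frames are independent with the same reception
probability `r` for a given node, so the node is missed with probability `(1 - r) ^ Mf`. Jensen's
inequality under the Palm distribution of a neighbor (`pow_mul_le_tsum_lintegral`) bounds the error
probability below by `(1 - c) ^ Mf` if `c ≤ 1` and the expected number of neighbors received in one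
frame is at most `c` times the expected number of neighbors. The latter is `λ π θ ^ (-b) Γ(1 + b)`
(`tsum_measure_isNeighbor`). What remains is to bound the former and to identify `c`.

Counting all received nodes, neighbors or not, only increases the number. For fixed positions the
signal fades exponentially, so the probability of reception from a node at distance `r` is
`p (1 - p)` times the Laplace transform of noise plus interference at `δ r ^ α`; the transform is a
product over the other nodes, of factors that depend on the distances only
(`lintegral_receptionProb_le`).

The expected sum over the nodes of such a product is at most what the Slivnyak–Mecke formula gives
(`tsum_lintegral_le`). Only numbers of points in disjoint sets are available, so the plane is cut
into the annuli between radii `q ^ k` and `q ^ (k + 1)`. A node in one annulus is paired with the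
nodes in the other ones, whose numbers are independent Poisson variables; monotonicity in the
distances and `q → 1` give the integral
`λ ∫ exp (-δ |x| ^ α / γ - C δ ^ b |x| ^ 2) dx` with `C = λ p b π ^ 2 / sin (b π)`.

In polar coordinates with `s = δ |x| ^ α` this is a multiple of
`∫_0^∞ s ^ (b - 1) exp (-C s ^ b - s / γ) ds`. Rotating the half-line to the imaginary half-axes
turns it into the integral of `alohaIntegrand` (`re_integral_alohaIntegrand`). The rotation is
carried out by differentiation in the angle, and the constants match by the reflection formula
(`reception_constant_eq`).
-/

noncomputable section

open Set Filter Topology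

/-! ### Rotation of the contour -/

/-- The form `z ^ (b - 1) * exp (-C z ^ b - g z) dz` along the ray of argument `φ`, as a function of
the distance `s` to the origin. The factor `exp (ι φ b)` is the direction of `z ^ (b - 1) dz`. -/
def rayIntegrand (C g b φ s : ℝ) : ℂ :=
  ((s ^ (b - 1) : ℝ) : ℂ) * Complex.exp (Complex.I * (φ * b : ℝ)
    - C * Complex.exp (Complex.I * (φ * b : ℝ)) * (s ^ b : ℝ) - g * Complex.exp (Complex.I * φ) * s)

lemma norm_rayExp_le {C g b φ s : ℝ} (hC : 0 ≤ C) (hg : 0 ≤ g) (hb0 : 0 < b) (hb1 : b < 1)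
    (hφ0 : 0 ≤ φ) (hφ1 : φ ≤ Real.pi / 2) (hs : 0 ≤ s) :
    ‖Complex.exp (Complex.I * (φ * b : ℝ)
    - C * Complex.exp (Complex.I * (φ * b : ℝ)) * (s ^ b : ℝ)
    - g * Complex.exp (Complex.I * φ) * s)‖
      ≤ Real.exp (-(C * Real.cos (b * Real.pi / 2)) * s ^ b) := by
  rw [Complex.norm_exp, Real.exp_le_exp]
  have h1 : ∀ x : ℝ, Complex.exp (Complex.I * x) = Real.cos x + Real.sin x * Complex.I := by
    intro x; rw [mul_comm, Complex.exp_mul_I]; simp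
  rw [h1, h1]
  simp only [Complex.sub_re, Complex.mul_re, Complex.add_re, Complex.I_re, Complex.I_im,
    Complex.ofReal_re, Complex.ofReal_im, Complex.mul_im, Complex.add_im]
  have hc1 : Real.cos (b * Real.pi / 2) ≤ Real.cos (φ * b) := by
    apply Real.cos_le_cos_of_nonneg_of_le_pi
    · positivity
    · nlinarith [Real.pi_pos]
    · nlinarith [Real.pi_pos]
  have hc2 : 0 ≤ Real.cos φ := Real.cos_nonneg_of_mem_Icc ⟨by linarith, hφ1⟩
  have h2 : 0 ≤ s ^ b := Real.rpow_nonneg hs _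
  have h3 : 0 ≤ g * Real.cos φ * s := by positivity
  have h4 : C * Real.cos (b * Real.pi / 2) * s ^ b ≤ C * Real.cos (φ * b) * s ^ b := by gcongr
  linarith

lemma norm_rayIntegrand_le {C g b φ s : ℝ} (hC : 0 ≤ C) (hg : 0 ≤ g) (hb0 : 0 < b) (hb1 : b < 1)
    (hφ0 : 0 ≤ φ) (hφ1 : φ ≤ Real.pi / 2) (hs : 0 ≤ s) :
    ‖rayIntegrand C g b φ s‖
      ≤ s ^ (b - 1) * Real.exp (-(C * Real.cos (b * Real.pi / 2)) * s ^ b) := by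
  have h2 : 0 ≤ s ^ (b - 1) := Real.rpow_nonneg hs _
  rw [rayIntegrand, norm_mul, Complex.norm_real, Real.norm_of_nonneg h2]
  gcongr
  exact norm_rayExp_le hC hg hb0 hb1 hφ0 hφ1 hs

lemma measurable_rayIntegrand (C g b φ : ℝ) : Measurable (rayIntegrand C g b φ) := by
  unfold rayIntegrand; fun_prop

lemma continuous_rayIntegrand_arg (C g b s : ℝ) :
    Continuous fun φ => rayIntegrand C g b φ s := by
  unfold rayIntegrand; fun_prop

/-- The factor by which `rayIntegrand` is multiplied in the derivative of `s * rayIntegrand` with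
respect to `s` and, up to `ι`, in the derivative of `rayIntegrand` with respect to `φ`. That it is
the same factor is the Cauchy–Riemann equation in polar coordinates. -/
def rayFactor (C g b φ s : ℝ) : ℂ :=
  b - b * C * Complex.exp (Complex.I * (φ * b : ℝ)) * (s ^ b : ℝ)
    - g * Complex.exp (Complex.I * φ) * s

lemma measurable_rayFactor (C g b φ : ℝ) : Measurable (rayFactor C g b φ) := by
  unfold rayFactor; fun_prop

lemma norm_rayFactor_le {C g b φ s : ℝ} (hC : 0 ≤ C) (hg : 0 ≤ g) (hb : 0 < b) (hs : 0 ≤ s) :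
    ‖rayFactor C g b φ s‖ ≤ b + b * C * s ^ b + g * s := by
  have h2 : 0 ≤ s ^ b := Real.rpow_nonneg hs _
  have h1 : ∀ x : ℝ, ‖Complex.exp (Complex.I * x)‖ = 1 := by
    intro x; rw [mul_comm, Complex.norm_exp_ofReal_mul_I]
  unfold rayFactor
  refine (norm_sub_le _ _).trans (add_le_add ((norm_sub_le _ _).trans (add_le_add ?_ ?_)) ?_)
  · simp [abs_of_pos hb]
  · simp only [norm_mul, h1, Complex.norm_real, Real.norm_eq_abs, abs_of_pos hb, abs_of_nonneg hC,
      abs_of_nonneg h2, mul_one]; rfl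
  · simp only [norm_mul, h1, Complex.norm_real, Real.norm_eq_abs, abs_of_nonneg hg,
      abs_of_nonneg hs, mul_one]; rfl

lemma hasDerivAt_rayIntegrand_arg (C g b φ s : ℝ) :
    HasDerivAt (fun φ : ℝ => rayIntegrand C g b φ s)
      (Complex.I * (rayIntegrand C g b φ s * rayFactor C g b φ s)) φ := by
  unfold rayIntegrand rayFactor
  have h0 : HasDerivAt (fun φ : ℝ => (φ : ℂ)) 1 φ := Complex.ofRealCLM.hasDerivAt
  have h1 : HasDerivAt (fun φ : ℝ => Complex.I * ((φ * b : ℝ) : ℂ)) (Complex.I * b) φ := by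
    have := (h0.mul_const (b : ℂ)).const_mul Complex.I
    simpa using this
  have h2 : HasDerivAt (fun φ : ℝ => Complex.I * (φ : ℂ)) Complex.I φ := by
    simpa using h0.const_mul Complex.I
  have := (((h1.sub ((h1.cexp.const_mul (C : ℂ)).mul_const ((s ^ b : ℝ) : ℂ))).sub
    ((h2.cexp.const_mul (g : ℂ)).mul_const (s : ℂ))).cexp).const_mul (((s ^ (b - 1) : ℝ) : ℂ))
  refine this.congr_deriv ?_
  simp only [Pi.sub_apply]
  ring

lemma hasDerivAt_mul_rayIntegrand {C g b φ s : ℝ} (hs : 0 < s) :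
    HasDerivAt (fun s : ℝ => ((s ^ b : ℝ) : ℂ) * Complex.exp (Complex.I * (φ * b : ℝ)
    - C * Complex.exp (Complex.I * (φ * b : ℝ)) * (s ^ b : ℝ)
    - g * Complex.exp (Complex.I * φ) * s))
      (rayIntegrand C g b φ s * rayFactor C g b φ s) s := by
  unfold rayIntegrand rayFactor
  have h0 : HasDerivAt (fun s : ℝ => (s : ℂ)) 1 s := Complex.ofRealCLM.hasDerivAt
  have h1 : HasDerivAt (fun s : ℝ => ((s ^ b : ℝ) : ℂ)) ((b * s ^ (b - 1) : ℝ) : ℂ) s :=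
    (Real.hasDerivAt_rpow_const (Or.inl hs.ne')).ofReal_comp
  have := h1.mul ((((hasDerivAt_const s (Complex.I * ((φ * b : ℝ) : ℂ))).sub
    (h1.const_mul (C * Complex.exp (Complex.I * ((φ * b : ℝ) : ℂ))))).sub
    (h0.const_mul (g * Complex.exp (Complex.I * φ)))).cexp)
  refine this.congr_deriv ?_
  have e : ((s ^ b : ℝ) : ℂ) = ((s ^ (b - 1) : ℝ) : ℂ) * s := by
    rw [← Complex.ofReal_mul]; congr 1
    rw [Real.rpow_sub_one hs.ne']; field_simp
  simp only [Pi.sub_apply]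
  rw [e]; push_cast
  ring

lemma integrableOn_ray_bound {b κ : ℝ} (hb0 : 0 < b) (hκ : 0 < κ) (A B D : ℝ) :
    IntegrableOn (fun s : ℝ => s ^ (b - 1) * Real.exp (-κ * s ^ b) * (A + B * s ^ b + D * s))
      (Ioi 0) := by
  have h1 := (integrableOn_rpow_mul_exp_neg_mul_rpow (p := b) (s := b - 1) (b := κ) (by linarith)
    hb0 hκ).const_mul A
  have h2 := (integrableOn_rpow_mul_exp_neg_mul_rpow (p := b) (s := b - 1 + b) (b := κ)
    (by linarith) hb0 hκ).const_mul B
  have h3 := (integrableOn_rpow_mul_exp_neg_mul_rpow (p := b) (s := b - 1 + 1) (b := κ)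
    (by linarith) hb0 hκ).const_mul D
  refine IntegrableOn.congr_fun (Integrable.add (Integrable.add h1 h2) h3) (fun s hs => ?_)
    measurableSet_Ioi
  have hs : 0 < s := hs
  simp only [Pi.add_apply]
  rw [Real.rpow_add hs, Real.rpow_add hs, Real.rpow_one]
  ring

lemma integrableOn_rayIntegrand {C g b φ : ℝ} (hC : 0 < C) (hg : 0 ≤ g) (hb0 : 0 < b) (hb1 : b < 1)
    (hφ0 : 0 ≤ φ) (hφ1 : φ ≤ Real.pi / 2) : IntegrableOn (rayIntegrand C g b φ) (Ioi 0) := by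
  have hκ : 0 < C * Real.cos (b * Real.pi / 2) :=
    mul_pos hC (Real.cos_pos_of_mem_Ioo ⟨by nlinarith [Real.pi_pos], by nlinarith [Real.pi_pos]⟩)
  refine Integrable.mono' (integrableOn_ray_bound hb0 hκ 1 0 0)
    (measurable_rayIntegrand _ _ _ _).aestronglyMeasurable ?_
  filter_upwards [ae_restrict_mem measurableSet_Ioi] with s hs
  simpa using norm_rayIntegrand_le hC.le hg hb0 hb1 hφ0 hφ1 (le_of_lt hs)

lemma norm_rayIntegrand_mul_rayFactor_le {C g b φ s : ℝ} (hC : 0 ≤ C) (hg : 0 ≤ g) (hb0 : 0 < b)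
    (hb1 : b < 1) (hφ0 : 0 ≤ φ) (hφ1 : φ ≤ Real.pi / 2) (hs : 0 ≤ s) :
    ‖rayIntegrand C g b φ s * rayFactor C g b φ s‖ ≤
      s ^ (b - 1) * Real.exp (-(C * Real.cos (b * Real.pi / 2)) * s ^ b) *
        (b + b * C * s ^ b + g * s) := by
  rw [norm_mul]
  gcongr
  · exact norm_rayIntegrand_le hC hg hb0 hb1 hφ0 hφ1 hs
  · exact norm_rayFactor_le hC hg hb0 hs

/-- The integrand is the derivative in `s` of a function that vanishes at `0` and at infinity. -/
lemma integral_rayIntegrand_mul_rayFactor {C g b φ : ℝ} (hC : 0 < C) (hg : 0 ≤ g) (hb0 : 0 < b)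
    (hb1 : b < 1) (hφ0 : 0 ≤ φ) (hφ1 : φ ≤ Real.pi / 2) :
    ∫ s in Ioi (0 : ℝ), rayIntegrand C g b φ s * rayFactor C g b φ s = 0 := by
  have hκ : 0 < C * Real.cos (b * Real.pi / 2) :=
    mul_pos hC (Real.cos_pos_of_mem_Ioo ⟨by nlinarith [Real.pi_pos], by nlinarith [Real.pi_pos]⟩)
  have hcont : Continuous (fun s : ℝ => ((s ^ b : ℝ) : ℂ) * Complex.exp (Complex.I * (φ * b : ℝ)
    - C * Complex.exp (Complex.I * (φ * b : ℝ)) * (s ^ b : ℝ)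
    - g * Complex.exp (Complex.I * φ) * s)) := by
    have : Continuous fun s : ℝ => s ^ b := Real.continuous_rpow_const hb0.le
    fun_prop
  have hint : IntegrableOn (fun s => rayIntegrand C g b φ s * rayFactor C g b φ s) (Ioi 0) := by
    refine Integrable.mono' (integrableOn_ray_bound hb0 hκ b (b * C) g)
      ((measurable_rayIntegrand _ _ _ _).mul
        (measurable_rayFactor _ _ _ _)).aestronglyMeasurable ?_
    filter_upwards [ae_restrict_mem measurableSet_Ioi] with s hs
    exact norm_rayIntegrand_mul_rayFactor_le hC.le hg hb0 hb1 hφ0 hφ1 (le_of_lt hs)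
  rw [integral_Ioi_of_hasDerivAt_of_tendsto (m := 0) hcont.continuousWithinAt
    (fun s hs => hasDerivAt_mul_rayIntegrand hs) hint]
  · simp [Real.zero_rpow hb0.ne']
  · have h1 : Tendsto (fun s : ℝ => s ^ b * Real.exp (-(C * Real.cos (b * Real.pi / 2)) * s ^ b))
        atTop (𝓝 0) := by
      have h := (Real.tendsto_pow_mul_exp_neg_atTop_nhds_zero 1).comp
        ((tendsto_rpow_atTop hb0).const_mul_atTop hκ)
      have h' := h.const_mul (C * Real.cos (b * Real.pi / 2))⁻¹
      rw [mul_zero] at h'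
      refine h'.congr fun s => ?_
      simp only [Function.comp, pow_one]
      rw [neg_mul, ← mul_assoc, inv_mul_cancel_left₀ hκ.ne']
    refine squeeze_zero_norm' ?_ h1
    filter_upwards [eventually_ge_atTop 0] with s hs
    have h2 : 0 ≤ s ^ b := Real.rpow_nonneg hs _
    rw [norm_mul, Complex.norm_real, Real.norm_of_nonneg h2]
    gcongr
    exact norm_rayExp_le hC.le hg hb0 hb1 hφ0 hφ1 hs

/-- Rotation of the contour: differentiate under the integral sign in the argument `φ`; by
Cauchy–Riemann the derivative is the integral of an exact differential in `s`. -/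
lemma integral_rayIntegrand_const {C g b : ℝ} (hC : 0 < C) (hg : 0 ≤ g) (hb0 : 0 < b)
    (hb1 : b < 1) :
    ∫ s in Ioi (0 : ℝ), rayIntegrand C g b (Real.pi / 2) s =
      ∫ s in Ioi (0 : ℝ), rayIntegrand C g b 0 s := by
  have hκ : 0 < C * Real.cos (b * Real.pi / 2) :=
    mul_pos hC (Real.cos_pos_of_mem_Ioo ⟨by nlinarith [Real.pi_pos], by nlinarith [Real.pi_pos]⟩)
  set F : ℝ → ℂ := fun φ => ∫ s in Ioi (0 : ℝ), rayIntegrand C g b φ s with hF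
  have hcont : ContinuousOn F (Icc 0 (Real.pi / 2)) := by
    refine continuousOn_of_dominated
      (bound := fun s => s ^ (b - 1) * Real.exp (-(C * Real.cos (b * Real.pi / 2)) * s ^ b))
      ?_ ?_ ?_ ?_
    · exact fun φ _ => (measurable_rayIntegrand _ _ _ _).aestronglyMeasurable
    · intro φ hφ
      filter_upwards [ae_restrict_mem measurableSet_Ioi] with s hs
      exact norm_rayIntegrand_le hC.le hg hb0 hb1 hφ.1 hφ.2 (le_of_lt hs)
    · simpa [IntegrableOn] using integrableOn_ray_bound hb0 hκ 1 0 0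
    · exact Eventually.of_forall fun s => (continuous_rayIntegrand_arg _ _ _ _).continuousOn
  have hderiv : ∀ φ ∈ Ioo 0 (Real.pi / 2), HasDerivAt F 0 φ := by
    intro φ hφ
    have h := (hasDerivAt_integral_of_dominated_loc_of_deriv_le
      (μ := volume.restrict (Ioi (0 : ℝ))) (F := fun φ s => rayIntegrand C g b φ s)
      (F' := fun φ s => Complex.I * (rayIntegrand C g b φ s * rayFactor C g b φ s))
      (x₀ := φ) (s := Ioo 0 (Real.pi / 2))
      (bound := fun s => s ^ (b - 1) * Real.exp (-(C * Real.cos (b * Real.pi / 2)) * s ^ b) *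
        (b + b * C * s ^ b + g * s)) (Ioo_mem_nhds hφ.1 hφ.2)
      (Eventually.of_forall fun φ => (measurable_rayIntegrand _ _ _ _).aestronglyMeasurable)
      (integrableOn_rayIntegrand hC hg hb0 hb1 hφ.1.le hφ.2.le)
      ((measurable_rayIntegrand _ _ _ _).mul
        (measurable_rayFactor _ _ _ _)|>.const_mul _).aestronglyMeasurable
      ?_ (integrableOn_ray_bound hb0 hκ _ _ _)
      (Eventually.of_forall fun s φ _ => hasDerivAt_rayIntegrand_arg _ _ _ _ _)).2
    · rwa [integral_const_mul, integral_rayIntegrand_mul_rayFactor hC hg hb0 hb1 hφ.1.le hφ.2.le,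
        mul_zero] at h
    · filter_upwards [ae_restrict_mem measurableSet_Ioi] with s hs ψ hψ
      rw [norm_mul, Complex.norm_I, one_mul]
      exact norm_rayIntegrand_mul_rayFactor_le hC.le hg hb0 hb1 hψ.1.le hψ.2.le (le_of_lt hs)
  have hpi : (0 : ℝ) ≤ Real.pi / 2 := by positivity
  have h := intervalIntegral.integral_eq_sub_of_hasDerivAt_of_le hpi hcont hderiv
    intervalIntegrable_const
  rw [intervalIntegral.integral_zero] at h
  exact (sub_eq_zero.mp h.symm)

lemma I_mul_ofReal_cpow {w : ℝ} (hw : 0 < w) (b : ℝ) :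
    (Complex.I * (w : ℂ)) ^ (b : ℂ) =
      Complex.exp (Complex.I * ((Real.pi / 2 * b : ℝ) : ℂ)) * ((w ^ b : ℝ) : ℂ) := by
  have hw' : (w : ℂ) ≠ 0 := by exact_mod_cast hw.ne'
  rw [Complex.cpow_def_of_ne_zero (mul_ne_zero Complex.I_ne_zero hw'), mul_comm Complex.I,
    Complex.log_ofReal_mul hw Complex.I_ne_zero, Complex.log_I, Real.rpow_def_of_pos hw,
    Complex.ofReal_exp, ← Complex.exp_add]
  congr 1
  push_cast
  ring

lemma alohaIntegrand_neg (lam p γ b w : ℝ) (hb : b ≠ 1) :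
    alohaIntegrand lam p γ b (-w) = (starRingEnd ℂ) (alohaIntegrand lam p γ b w) := by
  rcases eq_or_ne w 0 with rfl | hw
  · simp [alohaIntegrand, Real.zero_rpow (sub_ne_zero.mpr hb)]
  have harg : (Complex.I * (w : ℂ)).arg ≠ Real.pi := by
    intro h
    have := (Complex.arg_eq_pi_iff.mp h).2
    simp [hw] at this
  have h1 : (Complex.I * ((-w : ℝ) : ℂ)) ^ (b : ℂ) =
      (starRingEnd ℂ) ((Complex.I * (w : ℂ)) ^ (b : ℂ)) := by
    have h := Complex.conj_cpow _ (b : ℂ) harg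
    rw [Complex.conj_ofReal] at h
    rw [← h]
    simp
  unfold alohaIntegrand
  rw [h1, map_mul, Complex.conj_ofReal, abs_neg, ← Complex.exp_conj]
  simp only [map_sub, map_mul, map_neg, Complex.conj_ofReal, Complex.conj_I, neg_div,
    Complex.ofReal_neg, neg_mul, mul_neg]

lemma im_integral_alohaIntegrand (lam p γ b : ℝ) (hb : b ≠ 1) :
    (∫ w : ℝ, alohaIntegrand lam p γ b w).im = 0 := by
  rw [← Complex.conj_eq_iff_im, ← integral_conj]
  simp_rw [← alohaIntegrand_neg _ _ _ _ _ hb]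
  exact integral_neg_eq_self _ volume

lemma rayIntegrand_half_pi {lam p γ b w : ℝ} (hw : 0 < w) :
    rayIntegrand (lam * p * (b * Real.pi ^ 2 / Real.sin (b * Real.pi))) (1 / γ) b (Real.pi / 2) w =
      Complex.exp (Complex.I * ((Real.pi / 2 * b : ℝ) : ℂ)) * alohaIntegrand lam p γ b w := by
  unfold rayIntegrand alohaIntegrand
  rw [I_mul_ofReal_cpow hw, abs_of_pos hw]
  have h : Complex.exp (Complex.I * ((Real.pi / 2 : ℝ) : ℂ)) = Complex.I := by
    rw [mul_comm]; push_cast; exact Complex.exp_pi_div_two_mul_I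
  rw [h, mul_left_comm, ← Complex.exp_add]
  congr 2
  push_cast
  ring

lemma rayIntegrand_zero (C g b s : ℝ) :
    rayIntegrand C g b 0 s = ((s ^ (b - 1) * Real.exp (-(C * s ^ b) - g * s) : ℝ) : ℂ) := by
  unfold rayIntegrand
  push_cast
  congr 2
  simp

/-- The contour integral on the positive half-line: the integral of `rayIntegrand` for `φ = 0`. For
`0 < b` and `0 < g` it is `Γ(b)` times the mean of `(Y + g) ^ (-b)`, for a random variable `Y ≥ 0`
with Laplace transform `exp (-C s ^ b)`. -/
def rotatedIntegral (C g b : ℝ) : ℝ :=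
  ∫ s in Ioi (0 : ℝ), s ^ (b - 1) * Real.exp (-(C * s ^ b) - g * s)

lemma interferenceConst_pos {lam p b : ℝ} (hlam : 0 < lam) (hp : 0 < p) (hb0 : 0 < b)
    (hb1 : b < 1) : 0 < lam * p * (b * Real.pi ^ 2 / Real.sin (b * Real.pi)) := by
  have : 0 < Real.sin (b * Real.pi) := Real.sin_pos_of_pos_of_lt_pi (by positivity)
    (by nlinarith [Real.pi_pos])
  positivity

lemma integrableOn_alohaIntegrand_Ioi {lam p γ b : ℝ} (hlam : 0 < lam) (hp : 0 < p) (hγ : 0 < γ)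
    (hb0 : 0 < b) (hb1 : b < 1) : IntegrableOn (alohaIntegrand lam p γ b) (Ioi 0) := by
  have hC := interferenceConst_pos hlam hp hb0 hb1
  have h := integrableOn_rayIntegrand hC (g := 1 / γ) (by positivity) hb0 hb1
    (φ := Real.pi / 2) (by positivity) le_rfl
  refine IntegrableOn.congr_fun
    (Integrable.const_mul h (Complex.exp (-(Complex.I * ((Real.pi / 2 * b : ℝ) : ℂ)))))
    (fun w hw => ?_) measurableSet_Ioi
  rw [rayIntegrand_half_pi hw, ← mul_assoc, ← Complex.exp_add, neg_add_cancel, Complex.exp_zero,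
    one_mul]

lemma integrable_alohaIntegrand {lam p γ b : ℝ} (hlam : 0 < lam) (hp : 0 < p) (hγ : 0 < γ)
    (hb0 : 0 < b) (hb1 : b < 1) : Integrable (alohaIntegrand lam p γ b) := by
  have h := integrableOn_alohaIntegrand_Ioi hlam hp hγ hb0 hb1
  rw [← integrableOn_univ, ← Iic_union_Ioi (a := (0 : ℝ)), integrableOn_union]
  refine ⟨?_, h⟩
  rw [integrableOn_Iic_iff_integrableOn_Iio]
  have h2 := (Measure.measurePreserving_neg (volume : Measure ℝ)).integrableOn_comp_preimage
    (MeasurableEquiv.neg ℝ).measurableEmbedding (f := alohaIntegrand lam p γ b) (s := Iio 0)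
  rw [← h2]
  have h3 : Neg.neg ⁻¹' Iio (0 : ℝ) = Ioi 0 := by ext; simp
  rw [h3]
  have h4 : alohaIntegrand lam p γ b ∘ Neg.neg =
      fun w => (starRingEnd ℂ) (alohaIntegrand lam p γ b w) := by
    ext w; exact alohaIntegrand_neg _ _ _ _ _ hb1.ne
  rw [h4]
  exact (LinearIsometryEquiv.integrable_comp_iff Complex.conjLIE).mpr h

lemma integral_alohaIntegrand_Ioi {lam p γ b : ℝ} (hlam : 0 < lam) (hp : 0 < p) (hγ : 0 < γ)
    (hb0 : 0 < b) (hb1 : b < 1) :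
    ∫ w in Ioi (0 : ℝ), alohaIntegrand lam p γ b w =
      Complex.exp (-(Complex.I * ((Real.pi / 2 * b : ℝ) : ℂ))) *
        (rotatedIntegral (lam * p * (b * Real.pi ^ 2 / Real.sin (b * Real.pi))) (1 / γ) b : ℂ) := by
  have hC := interferenceConst_pos hlam hp hb0 hb1
  have h := integral_rayIntegrand_const hC (g := 1 / γ) (by positivity) hb0 hb1
  rw [setIntegral_congr_fun measurableSet_Ioi (fun w hw => rayIntegrand_half_pi hw),
    integral_const_mul] at h
  simp_rw [rayIntegrand_zero] at h
  rw [integral_complex_ofReal] at h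
  rw [rotatedIntegral, ← h, ← mul_assoc, ← Complex.exp_add, neg_add_cancel, Complex.exp_zero,
    one_mul]

lemma re_integral_alohaIntegrand {lam p γ b : ℝ} (hlam : 0 < lam) (hp : 0 < p) (hγ : 0 < γ)
    (hb0 : 0 < b) (hb1 : b < 1) :
    (∫ w : ℝ, alohaIntegrand lam p γ b w).re = 2 * Real.cos (b * Real.pi / 2) *
      rotatedIntegral (lam * p * (b * Real.pi ^ 2 / Real.sin (b * Real.pi))) (1 / γ) b := by
  have hint := integrable_alohaIntegrand hlam hp hγ hb0 hb1
  have h := integral_alohaIntegrand_Ioi hlam hp hγ hb0 hb1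
  have h1 : ∫ w in Iic (0 : ℝ), alohaIntegrand lam p γ b w =
      (starRingEnd ℂ) (∫ w in Ioi (0 : ℝ), alohaIntegrand lam p γ b w) := by
    rw [← integral_conj]
    simp_rw [← alohaIntegrand_neg _ _ _ _ _ hb1.ne]
    have := integral_comp_neg_Ioi (0 : ℝ) (alohaIntegrand lam p γ b)
    rw [this, neg_zero]
  have h2 : (Complex.exp (-(Complex.I * ((Real.pi / 2 * b : ℝ) : ℂ)))).re =
      Real.cos (b * Real.pi / 2) := by
    rw [← mul_neg, ← Complex.ofReal_neg, mul_comm, Complex.exp_ofReal_mul_I_re, Real.cos_neg]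
    congr 1; ring
  rw [← integral_add_compl (measurableSet_Iic (a := (0 : ℝ))) hint, compl_Iic, h1,
    Complex.add_re, Complex.conj_re, h, Complex.re_mul_ofReal, h2]
  ring

/-! ### Radial integrals over the plane -/

lemma integral_fun_norm_plane (f : ℝ → ℝ) :
    ∫ x : EuclideanSpace ℝ (Fin 2), f ‖x‖ = 2 * Real.pi * ∫ r in Ioi (0 : ℝ), r * f r := by
  rw [integral_fun_norm_addHaar volume f]
  simp [Measure.real, mul_assoc, Real.pi_pos.le]

lemma integral_exp_neg_mul_norm_rpow {α θ : ℝ} (hα : 0 < α) (hθ : 0 < θ) :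
    ∫ x : EuclideanSpace ℝ (Fin 2), Real.exp (-θ * ‖x‖ ^ α) =
      Real.pi * θ ^ (-(2 / α)) * ((2 / α) * Real.Gamma (2 / α)) := by
  rw [integral_fun_norm_plane (fun r => Real.exp (-θ * r ^ α))]
  have h := integral_rpow_mul_exp_neg_mul_rpow (p := α) (q := 1) (b := θ) hα (by norm_num) hθ
  simp only [Real.rpow_one] at h
  rw [h, show (1 + 1 : ℝ) = 2 by norm_num, neg_div]
  ring

lemma integrable_exp_neg_mul_norm_rpow {α θ : ℝ} (hα : 0 < α) (hθ : 0 < θ) :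
    Integrable fun x : EuclideanSpace ℝ (Fin 2) => Real.exp (-θ * ‖x‖ ^ α) := by
  have : 0 < ∫ x : EuclideanSpace ℝ (Fin 2), Real.exp (-θ * ‖x‖ ^ α) := by
    rw [integral_exp_neg_mul_norm_rpow hα hθ]
    have := Real.Gamma_pos_of_pos (s := 2 / α) (by positivity)
    positivity
  exact Integrable.of_integral_ne_zero this.ne'

lemma lintegral_exp_neg_mul_norm_rpow {α θ : ℝ} (hα : 0 < α) (hθ : 0 < θ) :
    ∫⁻ x : EuclideanSpace ℝ (Fin 2), ENNReal.ofReal (Real.exp (-θ * ‖x‖ ^ α)) =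
      ENNReal.ofReal (Real.pi * θ ^ (-(2 / α)) * ((2 / α) * Real.Gamma (2 / α))) := by
  rw [← integral_exp_neg_mul_norm_rpow hα hθ, ofReal_integral_eq_lintegral_ofReal
    (integrable_exp_neg_mul_norm_rpow hα hθ) (Eventually.of_forall fun x => (Real.exp_pos _).le)]

lemma ofReal_inv_one_add_eq_lintegral {t : ℝ} (ht : 0 ≤ t) :
    ENNReal.ofReal (1 / (1 + t)) =
      ∫⁻ z in Ioi (0 : ℝ), ENNReal.ofReal (Real.exp (-(1 + t) * z)) := by
  have h1 : -(1 + t) < 0 := by linarith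
  rw [← ofReal_integral_eq_lintegral_ofReal (integrableOn_exp_mul_Ioi h1 0)
    (Eventually.of_forall fun x => (Real.exp_pos _).le), integral_exp_mul_Ioi h1]
  congr 1
  simp [div_eq_mul_inv, neg_inv]

/-- Write `1 / (1 + t) = ∫ exp (-(1 + t) z) dz` and integrate over the plane first; what is left is
the reflection formula `Γ(b) Γ(1 - b) = π / sin (π b)`, where `b = 2 / α`. -/
lemma lintegral_inv_one_add_mul_norm_rpow {α c : ℝ} (hα : 2 < α) (hc : 0 < c) :
    ∫⁻ x : EuclideanSpace ℝ (Fin 2), ENNReal.ofReal (1 / (1 + c * ‖x‖ ^ α)) =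
      ENNReal.ofReal (c ^ (-(2 / α)) *
        ((2 / α) * Real.pi ^ 2 / Real.sin ((2 / α) * Real.pi))) := by
  have hα0 : 0 < α := by linarith
  set b := 2 / α with hb
  have hb0 : 0 < b := by positivity
  have hb1 : b < 1 := (div_lt_one hα0).mpr hα
  have hG := Real.Gamma_pos_of_pos hb0
  calc ∫⁻ x : EuclideanSpace ℝ (Fin 2), ENNReal.ofReal (1 / (1 + c * ‖x‖ ^ α))
      = ∫⁻ x : EuclideanSpace ℝ (Fin 2), ∫⁻ z in Ioi (0 : ℝ),
          ENNReal.ofReal (Real.exp (-(1 + c * ‖x‖ ^ α) * z)) := by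
        refine lintegral_congr fun x => ofReal_inv_one_add_eq_lintegral (by positivity)
    _ = ∫⁻ z in Ioi (0 : ℝ), ∫⁻ x : EuclideanSpace ℝ (Fin 2),
          ENNReal.ofReal (Real.exp (-(1 + c * ‖x‖ ^ α) * z)) := by
        rw [lintegral_lintegral_swap]
        fun_prop
    _ = ∫⁻ z in Ioi (0 : ℝ), ENNReal.ofReal (Real.pi * c ^ (-b) * (b * Real.Gamma b) *
          (Real.exp (-z) * z ^ ((1 - b) - 1))) := by
        refine setLIntegral_congr_fun measurableSet_Ioi fun z hz => ?_
        have hz : 0 < z := hz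
        have : ∀ x : EuclideanSpace ℝ (Fin 2),
            ENNReal.ofReal (Real.exp (-(1 + c * ‖x‖ ^ α) * z)) =
            ENNReal.ofReal (Real.exp (-z)) * ENNReal.ofReal (Real.exp (-(c * z) * ‖x‖ ^ α)) := by
          intro x
          rw [← ENNReal.ofReal_mul (Real.exp_pos _).le, ← Real.exp_add]
          congr 2; ring
        simp_rw [this]
        rw [lintegral_const_mul _ (by fun_prop),
          lintegral_exp_neg_mul_norm_rpow hα0 (by positivity),
          ← ENNReal.ofReal_mul (Real.exp_pos _).le, Real.mul_rpow hc.le hz.le]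
        congr 1
        rw [show 1 - b - 1 = -b by ring]
        ring
    _ = ENNReal.ofReal (Real.pi * c ^ (-b) * (b * Real.Gamma b) * Real.Gamma (1 - b)) := by
        have hconv := Real.GammaIntegral_convergent (s := 1 - b) (by linarith)
        rw [← ofReal_integral_eq_lintegral_ofReal (Integrable.const_mul hconv _),
          integral_const_mul, ← Real.Gamma_eq_integral (by linarith)]
        filter_upwards [ae_restrict_mem measurableSet_Ioi] with z hz
        have hz : 0 < z := hz
        simp only [Pi.zero_apply]
        positivity
    _ = _ := by
        congr 1
        have := Real.Gamma_mul_Gamma_one_sub b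
        rw [mul_comm Real.pi b] at this
        calc _ = Real.pi * c ^ (-b) * b * (Real.Gamma b * Real.Gamma (1 - b)) := by ring
          _ = _ := by rw [this]; ring

/-- The change of variables `s = δ ‖x‖ ^ α`. -/
lemma integral_exp_neg_sq_sub_rpow {α δ C g : ℝ} (hα : 2 < α) (hδ : 0 < δ) :
    ∫ x : EuclideanSpace ℝ (Fin 2),
        Real.exp (-(C * δ ^ (2 / α) * ‖x‖ ^ 2) - g * (δ * ‖x‖ ^ α)) =
      Real.pi * (2 / α) * δ ^ (-(2 / α)) * rotatedIntegral C g (2 / α) := by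
  have hα0 : 0 < α := by linarith
  rw [integral_fun_norm_plane (fun r => Real.exp (-(C * δ ^ (2 / α) * r ^ 2) - g * (δ * r ^ α)))]
  have h : rotatedIntegral C g (2 / α) = α * δ ^ (2 / α) *
      ∫ r in Ioi (0 : ℝ), r * Real.exp (-(C * δ ^ (2 / α) * r ^ 2) - g * (δ * r ^ α)) := by
    have h1 := integral_comp_mul_left_Ioi
      (fun s : ℝ => s ^ (2 / α - 1) * Real.exp (-(C * s ^ (2 / α)) - g * s)) 0 hδ
    rw [mul_zero] at h1
    rw [rotatedIntegral, (inv_smul_eq_iff₀ hδ.ne').mp h1.symm, smul_eq_mul,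
      ← integral_comp_rpow_Ioi_of_pos hα0, ← integral_const_mul, ← integral_const_mul]
    refine setIntegral_congr_fun measurableSet_Ioi fun r hr => ?_
    have hr : 0 < r := hr
    have e1 : (r ^ α) ^ (2 / α) = r ^ 2 := by
      rw [← Real.rpow_mul hr.le, mul_div_cancel₀ _ hα0.ne', ← Real.rpow_natCast]; norm_num
    have e2 : (δ * r ^ α) ^ (2 / α) = δ ^ (2 / α) * r ^ 2 := by
      rw [Real.mul_rpow hδ.le (by positivity), e1]
    have e3 : (δ * r ^ α) ^ (2 / α - 1) = δ ^ (2 / α) * r ^ 2 / (δ * r ^ α) := by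
      rw [Real.rpow_sub_one (by positivity), e2]
    simp only [smul_eq_mul]
    rw [e3, e2, Real.rpow_sub_one hr.ne']
    have : (0 : ℝ) < r ^ α := by positivity
    rw [← mul_assoc C]
    field_simp
  rw [h, Real.rpow_neg hδ.le]
  have : 0 < δ ^ (2 / α) := by positivity
  generalize ∫ r in Ioi (0 : ℝ), r * Real.exp (-(C * δ ^ (2 / α) * r ^ 2) - g * (δ * r ^ α)) = J
  field_simp

lemma integrable_exp_neg_sq_sub_rpow {α δ K g : ℝ} (hα : 2 < α) (hδ : 0 < δ) (hK : 0 ≤ K)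
    (hg : 0 < g) : Integrable fun x : EuclideanSpace ℝ (Fin 2) =>
      Real.exp (-(K * ‖x‖ ^ 2) - g * (δ * ‖x‖ ^ α)) := by
  refine Integrable.mono' (integrable_exp_neg_mul_norm_rpow (α := α) (θ := g * δ) (by linarith)
    (by positivity)) (by fun_prop) (Eventually.of_forall fun x => ?_)
  rw [Real.norm_of_nonneg (Real.exp_pos _).le, Real.exp_le_exp]
  nlinarith [mul_nonneg hK (sq_nonneg ‖x‖)]

lemma lintegral_exp_neg_sq_sub_rpow {α δ C g : ℝ} (hα : 2 < α) (hδ : 0 < δ) (hC : 0 ≤ C)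
    (hg : 0 < g) : ∫⁻ x : EuclideanSpace ℝ (Fin 2),
        ENNReal.ofReal (Real.exp (-(C * δ ^ (2 / α) * ‖x‖ ^ 2) - g * (δ * ‖x‖ ^ α))) =
      ENNReal.ofReal (Real.pi * (2 / α) * δ ^ (-(2 / α)) * rotatedIntegral C g (2 / α)) := by
  rw [← integral_exp_neg_sq_sub_rpow hα hδ, ofReal_integral_eq_lintegral_ofReal
    (integrable_exp_neg_sq_sub_rpow hα hδ (by positivity) hg)
    (Eventually.of_forall fun x => (Real.exp_pos _).le)]

/-! ### Poisson processes with enumerated points -/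

lemma sum_dirac_apply {E : Type*} [MeasurableSpace E] (x : ℕ → E) {B : Set E}
    (hB : MeasurableSet B) :
    Measure.sum (fun i => Measure.dirac (x i)) B =
      ∑' i, B.indicator (fun _ => (1 : ℝ≥0∞)) (x i) := by
  rw [Measure.sum_apply _ hB]
  simp_rw [Measure.dirac_apply' _ hB]
  rfl

lemma sum_dirac_apply_eq_encard {E : Type*} [MeasurableSpace E] (x : ℕ → E) {B : Set E}
    (hB : MeasurableSet B) :
    Measure.sum (fun i => Measure.dirac (x i)) B = ((x ⁻¹' B).encard : ℝ≥0∞) := by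
  rw [sum_dirac_apply x hB, ← ENNReal.tsum_set_one, tsum_subtype (x ⁻¹' B) (fun _ => (1 : ℝ≥0∞))]
  rfl

lemma sum_dirac_apply_eq_card {E : Type*} [MeasurableSpace E] (x : ℕ → E) {B : Set E}
    (hB : MeasurableSet B) (h : (x ⁻¹' B).Finite) :
    Measure.sum (fun i => Measure.dirac (x i)) B = (h.toFinset.card : ℝ≥0∞) := by
  rw [sum_dirac_apply_eq_encard x hB, h.encard_eq_coe_toFinset_card]
  simp

lemma finite_preimage_of_sum_dirac_lt_top {E : Type*} [MeasurableSpace E] (x : ℕ → E) {B : Set E}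
    (hB : MeasurableSet B) (h : Measure.sum (fun i => Measure.dirac (x i)) B ≠ ∞) :
    (x ⁻¹' B).Finite := by
  rw [sum_dirac_apply_eq_encard x hB] at h
  by_contra hinf
  rw [Set.Infinite.encard_eq hinf] at h
  simp at h

/-- If `a l` bounds the factors of the points in the cell `B l`, then the product of the factors of
all points in the cells is at most the product of the powers `a l ^ n`, with `n` the number of
points in `B l`. -/
lemma exists_finset_prod_le_prod_rpow_count {E ι : Type*} [MeasurableSpace E] (x : ℕ → E)
    (T : Finset ι) (B : ι → Set E) (hB : ∀ l ∈ T, MeasurableSet (B l))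
    (hdisj : ∀ j ∈ T, ∀ k ∈ T, j ≠ k → Disjoint (B j) (B k))
    (hfin : ∀ l ∈ T, Measure.sum (fun i => Measure.dirac (x i)) (B l) ≠ ∞)
    (w : E → ℝ) (a : ι → ℝ) (hw0 : ∀ y, 0 ≤ w y) (hw : ∀ l ∈ T, ∀ y ∈ B l, w y ≤ a l)
    (i : ℕ) (hi : ∀ l ∈ T, x i ∉ B l) :
    ∃ S : Finset ℕ, i ∉ S ∧ ∏ j ∈ S, w (x j) ≤
      ∏ l ∈ T, a l ^ (Measure.sum (fun i => Measure.dirac (x i)) (B l)).toReal := by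
  classical
  have hF : ∀ l ∈ T, (x ⁻¹' (B l)).Finite := fun l hl =>
    finite_preimage_of_sum_dirac_lt_top x (hB l hl) (hfin l hl)
  let s : ι → Finset ℕ := fun l => if h : (x ⁻¹' (B l)).Finite then h.toFinset else ∅
  have hs : ∀ l ∈ T, ∀ j, j ∈ s l ↔ x j ∈ B l := by
    intro l hl j
    simp only [s, dif_pos (hF l hl), Set.Finite.mem_toFinset, mem_preimage]
  refine ⟨T.biUnion s, ?_, ?_⟩
  · simp only [Finset.mem_biUnion, not_exists, not_and]
    intro l hl h
    exact hi l hl ((hs l hl i).mp h)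
  · rw [Finset.prod_biUnion]
    · refine Finset.prod_le_prod (fun l _ => Finset.prod_nonneg fun j _ => hw0 _) fun l hl => ?_
      rw [sum_dirac_apply_eq_card x (hB l hl) (hF l hl), ENNReal.toReal_natCast, Real.rpow_natCast]
      have : s l = (hF l hl).toFinset := by simp only [s, dif_pos (hF l hl)]
      rw [this]
      rw [← Finset.prod_const]
      refine Finset.prod_le_prod (fun j _ => hw0 _) fun j hj => hw l hl _ ?_
      rw [Set.Finite.mem_toFinset] at hj
      exact hj
    · intro j hj k hk hjk
      rw [Function.onFun, Finset.disjoint_left]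
      intro m hm hm'
      exact Set.disjoint_left.mp (hdisj j hj k hk hjk) ((hs j hj m).mp hm) ((hs k hk m).mp hm')

section Poisson

variable {Ω E : Type*} [MeasurableSpace Ω] [MeasurableSpace E]

lemma IsPoissonPP.lintegral_comp {N : Ω → Measure E} {μ : Measure E} {P : Measure Ω}
    (h : IsPoissonPP N μ P) {B : Set E} (hB : MeasurableSet B) (hμ : μ B ≠ ∞)
    {f : ℝ≥0∞ → ℝ≥0∞} (hf : Measurable f) :
    ∫⁻ ω, f (N ω B) ∂P = ∑' n : ℕ, ENNReal.ofReal
      (Real.exp (-(μ B).toReal) * (μ B).toReal ^ n / (n.factorial : ℝ)) * f n := by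
  rw [(h.count_law B hB hμ).lintegral_comp hf.aemeasurable, lintegral_map hf (by fun_prop),
    poissonMeasure, lintegral_sum_measure]
  simp only [lintegral_smul_measure, lintegral_dirac]
  rfl

lemma hasSum_poisson_mul_pow (m a : ℝ) :
    HasSum (fun n : ℕ => Real.exp (-m) * m ^ n / (n.factorial : ℝ) * a ^ n)
      (Real.exp (-(m * (1 - a)))) := by
  have h := (NormedSpace.expSeries_div_hasSum_exp (m * a)).mul_left (Real.exp (-m))
  rw [← Real.exp_eq_exp_ℝ, ← Real.exp_add] at h
  rw [show -(m * (1 - a)) = -m + m * a by ring]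
  convert! h using 2 with n
  rw [mul_pow]; ring

lemma hasSum_poisson_mul_self (m : ℝ) :
    HasSum (fun n : ℕ => Real.exp (-m) * m ^ n / (n.factorial : ℝ) * n) m := by
  have h := (hasSum_poisson_mul_pow m 1).mul_left m
  rw [sub_self, mul_zero, neg_zero, Real.exp_zero, mul_one] at h
  rw [← hasSum_nat_add_iff' 1]
  simp only [Finset.range_one, Finset.sum_singleton, Nat.cast_zero, mul_zero, sub_zero]
  convert! h using 2 with n
  rw [Nat.factorial_succ]
  push_cast
  field_simp
  ring

lemma IsPoissonPP.lintegral_count {N : Ω → Measure E} {μ : Measure E} {P : Measure Ω}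
    (h : IsPoissonPP N μ P) {B : Set E} (hB : MeasurableSet B) (hμ : μ B ≠ ∞) :
    ∫⁻ ω, N ω B ∂P = μ B := by
  have h1 := h.lintegral_comp hB hμ measurable_id
  simp only [id] at h1
  have h2 : ∀ n : ℕ, ENNReal.ofReal
      (Real.exp (-(μ B).toReal) * (μ B).toReal ^ n / (n.factorial : ℝ)) * (n : ℝ≥0∞) =
      ENNReal.ofReal
      (Real.exp (-(μ B).toReal) * (μ B).toReal ^ n / (n.factorial : ℝ) * n) := by
    intro n
    rw [ENNReal.ofReal_mul (by positivity), ENNReal.ofReal_natCast]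
  have h3 := hasSum_poisson_mul_self (μ B).toReal
  rw [h1]
  simp_rw [h2]
  rw [← ENNReal.ofReal_tsum_of_nonneg (fun n => by positivity) h3.summable, h3.tsum_eq,
    ENNReal.ofReal_toReal hμ]

lemma IsPoissonPP.lintegral_rpow_count {N : Ω → Measure E} {μ : Measure E} {P : Measure Ω}
    (h : IsPoissonPP N μ P) {B : Set E} (hB : MeasurableSet B) (hμ : μ B ≠ ∞) {a : ℝ}
    (ha : 0 ≤ a) :
    ∫⁻ ω, ENNReal.ofReal (a ^ (N ω B).toReal) ∂P =
      ENNReal.ofReal (Real.exp (-((μ B).toReal * (1 - a)))) := by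
  have h1 := h.lintegral_comp hB hμ (f := fun v => ENNReal.ofReal (a ^ v.toReal)) (by fun_prop)
  have h2 : ∀ n : ℕ, ENNReal.ofReal
      (Real.exp (-(μ B).toReal) * (μ B).toReal ^ n / (n.factorial : ℝ)) *
        ENNReal.ofReal (a ^ (n : ℝ≥0∞).toReal) =
      ENNReal.ofReal
      (Real.exp (-(μ B).toReal) * (μ B).toReal ^ n / (n.factorial : ℝ) * a ^ n) := by
    intro n
    rw [← ENNReal.ofReal_mul (by positivity), ENNReal.toReal_natCast, Real.rpow_natCast]
  have h3 := hasSum_poisson_mul_pow (μ B).toReal a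
  rw [h1]
  simp_rw [h2]
  rw [← ENNReal.ofReal_tsum_of_nonneg (fun n => by positivity) h3.summable, h3.tsum_eq]

lemma IsPoissonPP.ae_count_ne_top {N : Ω → Measure E} {μ : Measure E} {P : Measure Ω}
    (h : IsPoissonPP N μ P) {B : Set E} (hB : MeasurableSet B) (hμ : μ B ≠ ∞) :
    ∀ᵐ ω ∂P, N ω B ≠ ∞ :=
  (ae_lt_top' (h.count_law B hB hμ).aemeasurable
    (by rw [h.lintegral_count hB hμ]; exact hμ)).mono fun _ h => h.ne

lemma IsPoissonPP.iIndepFun_count {N : Ω → Measure E} {μ : Measure E} {P : Measure Ω}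
    (h : IsPoissonPP N μ P) {ι : Type*} [Fintype ι] (B : ι → Set E)
    (hB : ∀ l, MeasurableSet (B l)) (hμ : ∀ l, μ (B l) ≠ ∞)
    (hdisj : ∀ j k, j ≠ k → Disjoint (B j) (B k)) : iIndepFun (fun l ω => N ω (B l)) P := by
  have e := Fintype.equivFin ι
  have h1 := h.count_indep _ (fun k => B (e.symm k)) (fun k => hB _) (fun k => hμ _)
    (fun j k hjk => hdisj _ _ (fun h => hjk (e.symm.injective h)))
  have h2 := h1.precomp e.injective
  simp only [Equiv.symm_apply_apply] at h2
  exact h2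

/-- The number of points in one cell is independent of the numbers in the other cells, whose
generating functions are those of Poisson variables. -/
lemma IsPoissonPP.lintegral_count_mul_prod {N : Ω → Measure E} {μ : Measure E} {P : Measure Ω}
    (h : IsPoissonPP N μ P) (hN : ∀ B, MeasurableSet B → Measurable fun ω => N ω B)
    {ι : Type*} (T : Finset ι) (k : ι) (hk : k ∉ T)
    (B : ι → Set E) (hB : ∀ l, MeasurableSet (B l)) (hμ : ∀ l, μ (B l) ≠ ∞)
    (hdisj : ∀ j k, j ≠ k → Disjoint (B j) (B k)) (a : ι → ℝ) (ha : ∀ l, 0 ≤ a l) :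
    ∫⁻ ω, N ω (B k) * ∏ l ∈ T, ENNReal.ofReal (a l ^ (N ω (B l)).toReal) ∂P =
      μ (B k) * ENNReal.ofReal (Real.exp (-∑ l ∈ T, (μ (B l)).toReal * (1 - a l))) := by
  classical
  have hind := h.iIndepFun_count (ι := {l // l ∈ insert k T}) (fun l => B l) (fun l => hB l)
    (fun l => hμ l) (fun i j hij => hdisj i j (fun e => hij (Subtype.ext e)))
  let f : ι → ℝ≥0∞ → ℝ≥0∞ := fun l v => if l = k then v else ENNReal.ofReal (a l ^ v.toReal)
  have hf : ∀ l, Measurable (f l) := by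
    intro l
    by_cases hl : l = k
    · simp only [f, hl, if_true]; exact measurable_id
    · simp only [f, hl, if_false]; fun_prop
  have h1 := lintegral_prod_eq_prod_lintegral_of_indepFun Finset.univ _
    (hind.comp (fun l => f l) (fun l => hf l)) (fun l => (hf l).comp (hN _ (hB l)))
  simp only [Function.comp] at h1
  rw [Finset.prod_coe_sort (insert k T) (fun l => ∫⁻ ω, f l (N ω (B l)) ∂P)] at h1
  have h0 : ∀ ω, ∏ l : {l // l ∈ insert k T}, f l (N ω (B l)) =
      f k (N ω (B k)) * ∏ l ∈ T, f l (N ω (B l)) := fun ω => by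
    rw [Finset.prod_coe_sort (insert k T) (fun l => f l (N ω (B l))), Finset.prod_insert hk]
  simp_rw [h0, Finset.prod_insert hk] at h1
  have hne : ∀ l ∈ T, l ≠ k := fun l hl e => hk (e ▸ hl)
  have h2 : ∀ ω, ∏ l ∈ T, f l (N ω (B l)) = ∏ l ∈ T, ENNReal.ofReal (a l ^ (N ω (B l)).toReal) :=
    fun ω => Finset.prod_congr rfl fun l hl => by simp only [f, if_neg (hne l hl)]
  have h3 : ∏ l ∈ T, ∫⁻ ω, f l (N ω (B l)) ∂P =
      ENNReal.ofReal (Real.exp (-∑ l ∈ T, (μ (B l)).toReal * (1 - a l))) := by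
    rw [← Finset.sum_neg_distrib, Real.exp_sum,
      ENNReal.ofReal_prod_of_nonneg (fun _ _ => (Real.exp_pos _).le)]
    refine Finset.prod_congr rfl fun l hl => ?_
    simp only [f, if_neg (hne l hl)]
    exact h.lintegral_rpow_count (hB l) (hμ l) (ha l)
  simp_rw [h2] at h1
  rw [h3] at h1
  simp only [f, if_true] at h1
  rw [h1, h.lintegral_count (hB k) (hμ k)]

/-- Campbell's formula for a Poisson process whose points are enumerated. -/
lemma IsPoissonPP.tsum_lintegral_comp {x : ℕ → Ω → E} (hx : ∀ i, Measurable (x i))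
    {μ : Measure E} [SigmaFinite μ] {P : Measure Ω}
    (h : IsPoissonPP (fun ω => Measure.sum fun i => Measure.dirac (x i ω)) μ P)
    {f : E → ℝ≥0∞} (hf : Measurable f) :
    ∑' i, ∫⁻ ω, f (x i ω) ∂P = ∫⁻ y, f y ∂μ := by
  -- the mean measure agrees with `μ` on the sets of finite intensity
  have key : Measure.sum (fun i => P.map (x i)) = μ := by
    have h1 : ∀ B, MeasurableSet B → μ B ≠ ∞ → Measure.sum (fun i => P.map (x i)) B = μ B := by
      intro B hB hμ
      rw [← h.lintegral_count hB hμ, Measure.sum_apply _ hB]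
      simp_rw [sum_dirac_apply _ hB]
      have hm : ∀ i, Measurable fun ω => B.indicator (fun _ => (1 : ℝ≥0∞)) (x i ω) := fun i =>
        (measurable_const.indicator hB).comp (hx i)
      rw [lintegral_tsum (fun i => (hm i).aemeasurable)]
      refine tsum_congr fun i => ?_
      rw [Measure.map_apply (hx i) hB]
      have : (fun ω => B.indicator (fun _ => (1 : ℝ≥0∞)) (x i ω)) =
        (x i ⁻¹' B).indicator (fun _ => 1) := rfl
      rw [this, lintegral_indicator (hx i hB)]
      simp
    refine Measure.ext_of_iUnion_eq_univ (s := spanningSets μ) (iUnion_spanningSets μ) fun n => ?_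
    ext B hB
    rw [Measure.restrict_apply hB, Measure.restrict_apply hB]
    exact h1 _ (hB.inter (measurableSet_spanningSets μ n))
      ((measure_mono inter_subset_right).trans_lt (measure_spanningSets_lt_top μ n)).ne
  conv_rhs => rw [← key, lintegral_sum_measure]
  exact tsum_congr fun i => (lintegral_map hf (hx i)).symm

end Poisson

/-! ### A Palm bound by partition into annuli -/

/-- The annulus of the plane between the radii `q ^ k` and `q ^ (k + 1)`. -/
def annulus (q : ℝ) (k : ℤ) : Set (EuclideanSpace ℝ (Fin 2)) :=
  {x | q ^ k ≤ ‖x‖ ∧ ‖x‖ < q ^ (k + 1)}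

lemma measurableSet_annulus (q : ℝ) (k : ℤ) : MeasurableSet (annulus q k) :=
  (measurableSet_le measurable_const measurable_norm).inter
    (measurableSet_lt measurable_norm measurable_const)

lemma disjoint_annulus {q : ℝ} (hq : 1 < q) {j k : ℤ} (hjk : j ≠ k) :
    Disjoint (annulus q j) (annulus q k) := by
  wlog h : j < k generalizing j k
  · exact (this hjk.symm (lt_of_le_of_ne (not_lt.mp h) hjk.symm)).symm
  rw [Set.disjoint_left]
  intro x hx hx'
  have h1 : q ^ (j + 1) ≤ q ^ k := zpow_le_zpow_right₀ hq.le (by omega)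
  exact absurd (hx.2.trans_le (h1.trans hx'.1)) (lt_irrefl _)

lemma exists_mem_annulus {q : ℝ} (hq : 1 < q) {x : EuclideanSpace ℝ (Fin 2)} (hx : x ≠ 0) :
    ∃ k, x ∈ annulus q k :=
  exists_mem_Ico_zpow (norm_pos_iff.mpr hx) hq

lemma zero_notMem_annulus {q : ℝ} (hq : 1 < q) (k : ℤ) :
    (0 : EuclideanSpace ℝ (Fin 2)) ∉ annulus q k := by
  rintro ⟨h, -⟩
  rw [norm_zero] at h
  exact absurd h (not_le.mpr (zpow_pos (by linarith) k))

lemma iUnion_annulus {q : ℝ} (hq : 1 < q) : ⋃ k, annulus q k = {0}ᶜ := by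
  ext x
  simp only [mem_iUnion, mem_compl_iff, mem_singleton_iff]
  refine ⟨?_, exists_mem_annulus hq⟩
  rintro ⟨k, hk⟩ rfl
  exact zero_notMem_annulus hq k hk

lemma volume_annulus {q : ℝ} (hq : 1 < q) (k : ℤ) :
    volume (annulus q k) = ENNReal.ofReal (Real.pi * (q ^ k) ^ 2 * (q ^ 2 - 1)) := by
  have hq0 : 0 < q := by linarith
  have h : annulus q k = Metric.ball 0 (q ^ (k + 1)) \ Metric.ball 0 (q ^ k) := by
    ext x; simp [annulus, and_comm]
  have hk : 0 < q ^ k := zpow_pos hq0 k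
  have hvol : ∀ r : ℝ, 0 ≤ r → volume (Metric.ball (0 : EuclideanSpace ℝ (Fin 2)) r) =
      ENNReal.ofReal (r ^ 2 * Real.pi) := by
    intro r hr
    rw [EuclideanSpace.volume_ball_fin_two, ENNReal.ofReal_mul (by positivity),
      ENNReal.ofReal_pow hr]
  rw [h, measure_sdiff (Metric.ball_subset_ball
    (zpow_le_zpow_right₀ hq.le (by omega))) measurableSet_ball.nullMeasurableSet
    measure_ball_lt_top.ne, hvol _ (zpow_pos hq0 _).le, hvol _ hk.le,
    ← ENNReal.ofReal_sub _ (by positivity), zpow_add_one₀ hq0.ne']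
  congr 1
  ring

lemma volume_real_annulus {q : ℝ} (hq : 1 < q) (k : ℤ) :
    volume.real (annulus q k) = Real.pi * (q ^ k) ^ 2 * (q ^ 2 - 1) := by
  rw [measureReal_def, volume_annulus hq, ENNReal.toReal_ofReal]
  have : 0 ≤ q ^ 2 - 1 := by nlinarith
  positivity

/-- The Laplace transform, at `δ * r ^ α`, of the power received from a node at distance `ρ` that
transmits with probability `p`: the probability that this node alone does not spoil the reception
from a node at distance `r`. -/
def laplaceFactor (p δ α r ρ : ℝ) : ℝ := 1 - p + p * (1 / (1 + δ * r ^ α * ρ ^ (-α)))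

lemma laplaceFactor_nonneg {p δ α r ρ : ℝ} (hp0 : 0 ≤ p) (hp1 : p ≤ 1) (hδ : 0 < δ) (hr : 0 ≤ r)
    (hρ : 0 ≤ ρ) : 0 ≤ laplaceFactor p δ α r ρ := by
  unfold laplaceFactor
  have : 0 ≤ 1 - p := by linarith
  positivity

lemma laplaceFactor_le {p δ α r r' ρ ρ' : ℝ} (hp0 : 0 ≤ p) (hδ : 0 < δ) (hα : 0 < α)
    (hr : 0 ≤ r) (hrr' : r ≤ r') (hρ : 0 < ρ) (hρρ' : ρ ≤ ρ') :
    laplaceFactor p δ α r' ρ ≤ laplaceFactor p δ α r ρ' := by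
  unfold laplaceFactor
  have h1 : ρ' ^ (-α) ≤ ρ ^ (-α) := Real.rpow_le_rpow_of_nonpos hρ hρρ' (by linarith)
  have h2 : 0 ≤ ρ' ^ (-α) := Real.rpow_nonneg (by linarith) _
  have h3 : 0 ≤ r' := hr.trans hrr'
  gcongr

lemma one_sub_laplaceFactor {p δ α r ρ : ℝ} (hδ : 0 < δ) (hr : 0 < r) (hρ : 0 < ρ) :
    1 - laplaceFactor p δ α r ρ = p * (1 / (1 + ρ ^ α / (δ * r ^ α))) := by
  unfold laplaceFactor
  rw [Real.rpow_neg hρ.le]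
  have : 0 < r ^ α := by positivity
  have : 0 < ρ ^ α := by positivity
  field_simp
  ring

section

variable {Ω : Type*} [MeasurableSpace Ω] {P : Measure Ω}
  {x : ℕ → Ω → EuclideanSpace ℝ (Fin 2)} {lam p α δ g : ℝ} {K : ℝ≥0∞}
  {R : ℕ → (ℕ → EuclideanSpace ℝ (Fin 2)) → ℝ≥0∞}

/-- The contribution of the points in one annulus, when only the points of finitely many other
annuli are taken into account as interferers. Here and below `R i y` stands for a functional of the
point `y i` and all points `y`, bounded by a product over any finite set of the other points. -/
lemma tsum_lintegral_annulus_le_finset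
    (hx : ∀ i, Measurable (x i))
    (hPP : IsPoissonPP (fun ω => Measure.sum fun i => Measure.dirac (x i ω))
      (ENNReal.ofReal lam • volume) P)
    (hp0 : 0 ≤ p) (hp1 : p ≤ 1) (hα : 0 < α) (hδ : 0 < δ) (hg : 0 ≤ g)
    (hRm : ∀ i, Measurable (R i))
    (hR : ∀ i y (S : Finset ℕ), i ∉ S → R i y ≤
      K * ENNReal.ofReal (Real.exp (-(g * (δ * ‖y i‖ ^ α)))) *
        ENNReal.ofReal (∏ j ∈ S, laplaceFactor p δ α ‖y i‖ ‖y j‖))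
    {q : ℝ} (hq : 1 < q) (k : ℤ) (T : Finset ℤ) (hk : k ∉ T) :
    ∑' i, ∫⁻ ω, (annulus q k).indicator (fun _ => 1) (x i ω) * R i (fun j => x j ω) ∂P ≤
      K * ENNReal.ofReal (Real.exp (-(g * (δ * (q ^ k) ^ α)))) *
        (ENNReal.ofReal lam * volume (annulus q k) *
          ENNReal.ofReal (Real.exp (-∑ l ∈ T, (ENNReal.ofReal lam * volume (annulus q l)).toReal *
            (1 - laplaceFactor p δ α (q ^ k) (q ^ (l + 1)))))) := by
  have hq0 : 0 < q := by linarith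
  have hqk : ∀ l : ℤ, 0 < q ^ l := fun l => zpow_pos hq0 l
  have hμ : ∀ l, (ENNReal.ofReal lam • volume) (annulus q l) ≠ ∞ := by
    intro l
    rw [Measure.smul_apply, smul_eq_mul, volume_annulus hq]
    exact ENNReal.mul_ne_top ENNReal.ofReal_ne_top ENNReal.ofReal_ne_top
  have hxm : Measurable fun ω j => x j ω := measurable_pi_lambda _ hx
  have hind : ∀ (l : ℤ) i, Measurable fun ω =>
      (annulus q l).indicator (fun _ => (1 : ℝ≥0∞)) (x i ω) := fun l i =>
    (measurable_const.indicator (measurableSet_annulus q l)).comp (hx i)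
  have hN : ∀ B, MeasurableSet B →
      Measurable fun ω => (Measure.sum fun i => Measure.dirac (x i ω)) B := by
    intro B hB
    simp_rw [sum_dirac_apply _ hB]
    exact Measurable.tsum fun i =>
      (measurable_const.indicator hB).comp (hx i)
  have ha : ∀ l : ℤ, 0 ≤ laplaceFactor p δ α (q ^ k) (q ^ (l + 1)) := fun l =>
    laplaceFactor_nonneg hp0 hp1 hδ (hqk k).le (hqk _).le
  have h := hPP.lintegral_count_mul_prod hN T k hk (annulus q) (measurableSet_annulus q) hμ
    (fun j k hjk => disjoint_annulus hq hjk)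
    (fun l => laplaceFactor p δ α (q ^ k) (q ^ (l + 1))) ha
  simp only [Measure.smul_apply, smul_eq_mul] at h
  rw [← h, ← lintegral_const_mul, ← lintegral_tsum]
  · have hfin : ∀ᵐ ω ∂P, ∀ l ∈ T,
        (Measure.sum fun i => Measure.dirac (x i ω)) (annulus q l) ≠ ∞ := by
      rw [Filter.eventually_all_finset]
      intro l hl
      exact hPP.ae_count_ne_top (measurableSet_annulus q l) (hμ l)
    refine lintegral_mono_ae ?_
    filter_upwards [hfin] with ω hω
    rw [sum_dirac_apply (fun i => x i ω) (measurableSet_annulus q k), ← mul_assoc,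
      mul_right_comm, ← ENNReal.tsum_mul_left]
    refine ENNReal.tsum_le_tsum fun i => ?_
    by_cases hi : x i ω ∈ annulus q k
    · rw [indicator_of_mem hi, one_mul, mul_one]
      obtain ⟨S, hiS, hS⟩ := exists_finset_prod_le_prod_rpow_count (fun j => x j ω) T (annulus q)
        (fun l _ => measurableSet_annulus q l) (fun _ _ _ _ hjk => disjoint_annulus hq hjk) hω
        (fun y => laplaceFactor p δ α ‖x i ω‖ ‖y‖)
        (fun l => laplaceFactor p δ α (q ^ k) (q ^ (l + 1)))
        (fun y => laplaceFactor_nonneg hp0 hp1 hδ (norm_nonneg _) (norm_nonneg _))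
        (fun l _ y hy => laplaceFactor_le hp0 hδ hα (hqk k).le hi.1
          ((hqk l).trans_le hy.1) hy.2.le) i
        (fun l hl => Set.disjoint_left.mp
          (disjoint_annulus hq (fun e : k = l => hk (by rwa [e]))) hi)
      refine (hR i _ S hiS).trans ?_
      rw [← ENNReal.ofReal_prod_of_nonneg (fun l _ => Real.rpow_nonneg (ha l) _)]
      gcongr
      exact hi.1
    · rw [indicator_of_notMem hi, zero_mul]
      exact bot_le
  · intro i
    exact ((hind k i).mul ((hRm i).comp hxm)).aemeasurable
  · refine (hN _ (measurableSet_annulus q k)).mul (Finset.measurable_prod _ fun l _ => ?_)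
    have := hN _ (measurableSet_annulus q l)
    fun_prop

lemma integrable_inv_one_add_mul_norm_rpow {α c : ℝ} (hα : 2 < α) (hc : 0 < c) :
    Integrable fun x : EuclideanSpace ℝ (Fin 2) => 1 / (1 + c * ‖x‖ ^ α) := by
  refine ⟨Measurable.aestronglyMeasurable (by fun_prop), ?_⟩
  rw [hasFiniteIntegral_iff_ofReal (Eventually.of_forall fun x => by positivity),
    lintegral_inv_one_add_mul_norm_rpow hα hc]
  exact ENNReal.ofReal_lt_top

lemma integral_inv_one_add_mul_norm_rpow {α c : ℝ} (hα : 2 < α) (hc : 0 < c) :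
    ∫ x : EuclideanSpace ℝ (Fin 2), 1 / (1 + c * ‖x‖ ^ α) = c ^ (-(2 / α)) *
        ((2 / α) * Real.pi ^ 2 / Real.sin ((2 / α) * Real.pi)) := by
  have hα0 : 0 < α := by linarith
  have hs : 0 < Real.sin ((2 / α) * Real.pi) := Real.sin_pos_of_pos_of_lt_pi (by positivity)
    (by have := (div_lt_one hα0).mpr hα; nlinarith [Real.pi_pos])
  rw [integral_eq_lintegral_of_nonneg_ae (Eventually.of_forall fun x => by positivity)
    (integrable_inv_one_add_mul_norm_rpow hα hc).1, lintegral_inv_one_add_mul_norm_rpow hα hc,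
    ENNReal.toReal_ofReal (by positivity)]

/-- All annuli except that of the point itself are taken into account; the exclusion costs the term
with `q ^ 2 - 1`, which vanishes as `q → 1`. -/
lemma tsum_lintegral_annulus_le
    (hx : ∀ i, Measurable (x i))
    (hPP : IsPoissonPP (fun ω => Measure.sum fun i => Measure.dirac (x i ω))
      (ENNReal.ofReal lam • volume) P)
    (hlam : 0 < lam) (hp0 : 0 ≤ p) (hp1 : p ≤ 1) (hα : 2 < α) (hδ : 0 < δ) (hg : 0 ≤ g)
    (hK : K ≠ ∞) (hRm : ∀ i, Measurable (R i))
    (hR : ∀ i y (S : Finset ℕ), i ∉ S → R i y ≤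
      K * ENNReal.ofReal (Real.exp (-(g * (δ * ‖y i‖ ^ α)))) *
        ENNReal.ofReal (∏ j ∈ S, laplaceFactor p δ α ‖y i‖ ‖y j‖))
    {q : ℝ} (hq : 1 < q) (k : ℤ) :
    ∑' i, ∫⁻ ω, (annulus q k).indicator (fun _ => 1) (x i ω) * R i (fun j => x j ω) ∂P ≤
      K * ENNReal.ofReal (Real.exp (-(g * (δ * (q ^ k) ^ α)))) *
        (ENNReal.ofReal lam * volume (annulus q k) *
          ENNReal.ofReal (Real.exp (-(lam * p * (δ ^ (2 / α) *
            ((2 / α) * Real.pi ^ 2 / Real.sin ((2 / α) * Real.pi)) / q ^ 2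
              - Real.pi * (q ^ 2 - 1)) * (q ^ k) ^ 2)))) := by
  have hq0 : 0 < q := by linarith
  have hα0 : 0 < α := by linarith
  have hqk : ∀ l : ℤ, 0 < q ^ l := fun l => zpow_pos hq0 l
  -- `p * u` bounds `1 - laplaceFactor` from below on each annulus, with `q * ‖y‖` in the place of
  -- the outer radius
  set c : ℝ := q ^ α / (δ * (q ^ k) ^ α) with hc
  have hqka : 0 < (q ^ k) ^ α := Real.rpow_pos_of_pos (hqk k) _
  have hc0 : 0 < c := by positivity
  set u : EuclideanSpace ℝ (Fin 2) → ℝ := fun y => 1 / (1 + c * ‖y‖ ^ α) with hu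
  have hui : Integrable u := integrable_inv_one_add_mul_norm_rpow hα hc0
  have hvfin : ∀ l, volume (annulus q l) ≠ ∞ := fun l => by
    rw [volume_annulus hq]; exact ENNReal.ofReal_ne_top
  have hle : ∀ l, p * ∫ y in annulus q l, u y ≤
      volume.real (annulus q l) * (1 - laplaceFactor p δ α (q ^ k) (q ^ (l + 1))) := by
    intro l
    rw [one_sub_laplaceFactor hδ (hqk k) (hqk _), mul_left_comm]
    refine mul_le_mul_of_nonneg_left ?_ hp0
    rw [← smul_eq_mul (volume.real _), ← setIntegral_const]
    refine setIntegral_mono_on hui.integrableOn (integrableOn_const (hvfin l))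
      (measurableSet_annulus q l) fun y hy => ?_
    have h1 : (q ^ (l + 1)) ^ α ≤ q ^ α * ‖y‖ ^ α := by
      rw [← Real.mul_rpow hq0.le (norm_nonneg _)]
      refine Real.rpow_le_rpow (hqk _).le ?_ hα0.le
      rw [zpow_add_one₀ hq0.ne', mul_comm]
      exact mul_le_mul_of_nonneg_left hy.1 hq0.le
    have h2 : (q ^ (l + 1)) ^ α / (δ * (q ^ k) ^ α) ≤ c * ‖y‖ ^ α := by
      rw [hc, div_mul_eq_mul_div]
      gcongr
    have h3 : 0 ≤ (q ^ (l + 1)) ^ α / (δ * (q ^ k) ^ α) :=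
      div_nonneg (Real.rpow_nonneg (hqk _).le _) (by positivity)
    simp only [hu]
    exact one_div_le_one_div_of_le (by linarith) (by linarith)
  have hsum : HasSum (fun l => ∫ y in annulus q l, u y) (∫ y, u y) := by
    have h := hasSum_integral_iUnion (measurableSet_annulus q)
      (fun j k hjk => disjoint_annulus hq hjk) (hui.integrableOn (s := ⋃ l, annulus q l))
    rw [iUnion_annulus hq] at h
    rwa [Measure.restrict_eq_self_of_ae_mem] at h
    exact compl_mem_ae_iff.mpr (measure_singleton _)
  have hselfle : ∫ y in annulus q k, u y ≤ Real.pi * (q ^ k) ^ 2 * (q ^ 2 - 1) := by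
    rw [← volume_real_annulus hq, ← mul_one (volume.real _), ← smul_eq_mul, ← setIntegral_const]
    refine setIntegral_mono_on hui.integrableOn (integrableOn_const (hvfin k))
      (measurableSet_annulus q k) fun y hy => ?_
    simp only [hu]
    rw [div_le_one (by positivity)]
    have : 0 ≤ c * ‖y‖ ^ α := by positivity
    linarith
  have htot : ∫ y, u y = δ ^ (2 / α) *
      ((2 / α) * Real.pi ^ 2 / Real.sin ((2 / α) * Real.pi)) / q ^ 2 * (q ^ k) ^ 2 := by
    rw [hu, integral_inv_one_add_mul_norm_rpow hα hc0]
    have e : ∀ t : ℝ, 0 < t → (t ^ α) ^ (2 / α) = t ^ 2 := by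
      intro t ht
      rw [← Real.rpow_mul ht.le, mul_div_cancel₀ _ hα0.ne', ← Real.rpow_natCast]; norm_num
    have : c ^ (-(2 / α)) = δ ^ (2 / α) * (q ^ k) ^ 2 / q ^ 2 := by
      rw [Real.rpow_neg hc0.le, hc, Real.div_rpow (by positivity) (by positivity),
        Real.mul_rpow hδ.le hqka.le, e _ hq0, e _ (hqk k), inv_div]
    rw [this]; ring
  have hbound : ∀ T : Finset ℤ,
      ∑' i, ∫⁻ ω, (annulus q k).indicator (fun _ => 1) (x i ω) * R i (fun j => x j ω) ∂P ≤
      K * ENNReal.ofReal (Real.exp (-(g * (δ * (q ^ k) ^ α)))) *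
        (ENNReal.ofReal lam * volume (annulus q k) *
          ENNReal.ofReal (Real.exp (-(lam * p * (∑ l ∈ T, (∫ y in annulus q l, u y) -
            ∫ y in annulus q k, u y))))) := by
    intro T
    refine (tsum_lintegral_annulus_le_finset hx hPP hp0 hp1 hα0 hδ hg hRm hR hq k (T.erase k)
      (Finset.notMem_erase k T)).trans ?_
    gcongr
    have h1 : ∑ l ∈ T, (∫ y in annulus q l, u y) - ∫ y in annulus q k, u y ≤
        ∑ l ∈ T.erase k, ∫ y in annulus q l, u y := by
      have hk0 : 0 ≤ ∫ y in annulus q k, u y :=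
        setIntegral_nonneg (measurableSet_annulus q k) fun y _ => by positivity
      by_cases hkT : k ∈ T
      · rw [← Finset.add_sum_erase _ _ hkT]; linarith
      · rw [Finset.erase_eq_of_notMem hkT]; linarith
    refine (mul_le_mul_of_nonneg_left h1 (by positivity)).trans ?_
    rw [Finset.mul_sum]
    refine Finset.sum_le_sum fun l _ => ?_
    rw [ENNReal.toReal_mul, ENNReal.toReal_ofReal hlam.le, mul_assoc, mul_assoc]
    exact mul_le_mul_of_nonneg_left (hle l) hlam.le
  have hlim : Tendsto (fun T : Finset ℤ =>
      K * ENNReal.ofReal (Real.exp (-(g * (δ * (q ^ k) ^ α)))) *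
        (ENNReal.ofReal lam * volume (annulus q k) *
          ENNReal.ofReal (Real.exp (-(lam * p * (∑ l ∈ T, (∫ y in annulus q l, u y) -
            ∫ y in annulus q k, u y)))))) atTop
      (𝓝 (K * ENNReal.ofReal (Real.exp (-(g * (δ * (q ^ k) ^ α)))) *
        (ENNReal.ofReal lam * volume (annulus q k) *
          ENNReal.ofReal (Real.exp (-(lam * p * ((∫ y, u y) - ∫ y in annulus q k, u y))))))) := by
    refine ENNReal.Tendsto.const_mul (ENNReal.Tendsto.const_mul (ENNReal.tendsto_ofReal
      ((Real.continuous_exp.tendsto _).comp ((hsum.sub_const _).const_mul _).neg))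
      (Or.inr (ENNReal.mul_ne_top ENNReal.ofReal_ne_top (hvfin k))))
      (Or.inr (ENNReal.mul_ne_top hK ENNReal.ofReal_ne_top))
  refine (ge_of_tendsto hlim (Eventually.of_forall hbound)).trans ?_
  refine mul_le_mul_right (mul_le_mul_right (ENNReal.ofReal_le_ofReal
    (Real.exp_le_exp.mpr (neg_le_neg ?_))) _) _
  rw [htot, mul_assoc]
  refine mul_le_mul_of_nonneg_left ?_ (by positivity)
  linarith

/-- Sum over the annuli, and comparison with an integral over the plane: `‖y‖ / q ≤ q ^ k` on the
annulus between `q ^ k` and `q ^ (k + 1)`. -/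
lemma tsum_lintegral_le_of_one_lt
    (hx : ∀ i, Measurable (x i))
    (hPP : IsPoissonPP (fun ω => Measure.sum fun i => Measure.dirac (x i ω))
      (ENNReal.ofReal lam • volume) P)
    (hlam : 0 < lam) (hp0 : 0 ≤ p) (hp1 : p ≤ 1) (hα : 2 < α) (hδ : 0 < δ) (hg : 0 ≤ g)
    (hK : K ≠ ∞) (hRm : ∀ i, Measurable (R i)) (hR0 : ∀ i y, y i = 0 → R i y = 0)
    (hR : ∀ i y (S : Finset ℕ), i ∉ S → R i y ≤
      K * ENNReal.ofReal (Real.exp (-(g * (δ * ‖y i‖ ^ α)))) *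
        ENNReal.ofReal (∏ j ∈ S, laplaceFactor p δ α ‖y i‖ ‖y j‖))
    {q κ : ℝ} (hq : 1 < q) (hκ : κ = lam * p * (δ ^ (2 / α) *
            ((2 / α) * Real.pi ^ 2 / Real.sin ((2 / α) * Real.pi)) / q ^ 2
              - Real.pi * (q ^ 2 - 1))) (hκ0 : 0 ≤ κ) :
    ∑' i, ∫⁻ ω, R i (fun j => x j ω) ∂P ≤ K * ENNReal.ofReal lam *
      ∫⁻ y : EuclideanSpace ℝ (Fin 2),
        ENNReal.ofReal (Real.exp (-(κ * (‖y‖ / q) ^ 2) - g * (δ * (‖y‖ / q) ^ α))) := by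
  have hq0 : 0 < q := by linarith
  have hxm : Measurable fun ω j => x j ω := measurable_pi_lambda _ hx
  have hsplit : ∀ i y, R i y = ∑' k, (annulus q k).indicator (fun _ => 1) (y i) * R i y := by
    intro i y
    rcases eq_or_ne (y i) 0 with h0 | h0
    · simp [hR0 i y h0]
    obtain ⟨k, hk⟩ := exists_mem_annulus hq h0
    rw [tsum_eq_single k, indicator_of_mem hk, one_mul]
    intro l hl
    rw [indicator_of_notMem (Set.disjoint_left.mp (disjoint_annulus hq hl.symm) hk), zero_mul]
  have hm : ∀ i k, Measurable fun ω =>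
      (annulus q k).indicator (fun _ => 1) (x i ω) * R i (fun j => x j ω) := fun i k =>
    ((measurable_const.indicator (measurableSet_annulus q k)).comp (hx i)).mul ((hRm i).comp hxm)
  calc ∑' i, ∫⁻ ω, R i (fun j => x j ω) ∂P
      = ∑' i, ∑' k, ∫⁻ ω, (annulus q k).indicator (fun _ => 1) (x i ω) *
          R i (fun j => x j ω) ∂P := by
        refine tsum_congr fun i => ?_
        rw [← lintegral_tsum fun k => (hm i k).aemeasurable]
        exact lintegral_congr fun ω => hsplit i _
    _ = ∑' k, ∑' i, ∫⁻ ω, (annulus q k).indicator (fun _ => 1) (x i ω) *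
          R i (fun j => x j ω) ∂P := ENNReal.tsum_comm
    _ ≤ ∑' k, K * ENNReal.ofReal lam * ∫⁻ y in annulus q k,
        ENNReal.ofReal (Real.exp (-(κ * (‖y‖ / q) ^ 2) - g * (δ * (‖y‖ / q) ^ α))) := by
        refine ENNReal.tsum_le_tsum fun k => ?_
        refine (tsum_lintegral_annulus_le hx hPP hlam hp0 hp1 hα hδ hg hK hRm hR hq k).trans ?_
        rw [← hκ]
        have e : K * ENNReal.ofReal (Real.exp (-(g * (δ * (q ^ k) ^ α)))) *
            (ENNReal.ofReal lam * volume (annulus q k) *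
              ENNReal.ofReal (Real.exp (-(κ * (q ^ k) ^ 2)))) =
            K * ENNReal.ofReal lam * ∫⁻ y in annulus q k,
              ENNReal.ofReal (Real.exp (-(κ * (q ^ k) ^ 2) - g * (δ * (q ^ k) ^ α))) := by
          rw [setLIntegral_const, sub_eq_add_neg, Real.exp_add,
            ENNReal.ofReal_mul (Real.exp_pos _).le]
          ring
        rw [e]
        refine mul_le_mul_right (setLIntegral_mono (by fun_prop) fun y hy => ?_) _
        have h1 : ‖y‖ / q ≤ q ^ k := by
          rw [div_le_iff₀ hq0, ← zpow_add_one₀ hq0.ne']; exact hy.2.le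
        have h0 : 0 ≤ ‖y‖ / q := by positivity
        gcongr
    _ = K * ENNReal.ofReal lam * ∫⁻ y in ⋃ k, annulus q k,
        ENNReal.ofReal (Real.exp (-(κ * (‖y‖ / q) ^ 2) - g * (δ * (‖y‖ / q) ^ α))) := by
        rw [ENNReal.tsum_mul_left, lintegral_iUnion (measurableSet_annulus q)
          (fun j k hjk => disjoint_annulus hq hjk)]
    _ ≤ _ := by
        gcongr
        exact Measure.restrict_le_self

/-- The upper bound half of the Slivnyak–Mecke formula, for a product of factors that depend on the
distances only: refine the partition into annuli, `q → 1`. -/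
lemma tsum_lintegral_le
    (hx : ∀ i, Measurable (x i))
    (hPP : IsPoissonPP (fun ω => Measure.sum fun i => Measure.dirac (x i ω))
      (ENNReal.ofReal lam • volume) P)
    (hlam : 0 < lam) (hp0 : 0 ≤ p) (hp1 : p ≤ 1) (hα : 2 < α) (hδ : 0 < δ) (hg : 0 < g)
    (hK : K ≠ ∞) (hRm : ∀ i, Measurable (R i)) (hR0 : ∀ i y, y i = 0 → R i y = 0)
    (hR : ∀ i y (S : Finset ℕ), i ∉ S → R i y ≤
      K * ENNReal.ofReal (Real.exp (-(g * (δ * ‖y i‖ ^ α)))) *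
        ENNReal.ofReal (∏ j ∈ S, laplaceFactor p δ α ‖y i‖ ‖y j‖)) :
    ∑' i, ∫⁻ ω, R i (fun j => x j ω) ∂P ≤ K * ENNReal.ofReal lam *
      ∫⁻ y : EuclideanSpace ℝ (Fin 2), ENNReal.ofReal (Real.exp
        (-(lam * p * ((2 / α) * Real.pi ^ 2 / Real.sin ((2 / α) * Real.pi)) * δ ^ (2 / α) *
          ‖y‖ ^ 2) - g * (δ * ‖y‖ ^ α))) := by
  have hα0 : 0 < α := by linarith
  have hs : 0 < Real.sin ((2 / α) * Real.pi) := Real.sin_pos_of_pos_of_lt_pi (by positivity)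
    (by have := (div_lt_one hα0).mpr hα; nlinarith [Real.pi_pos])
  set D : ℝ := δ ^ (2 / α) * ((2 / α) * Real.pi ^ 2 / Real.sin ((2 / α) * Real.pi)) with hD
  have hD0 : 0 < D := by positivity
  have hlim : Tendsto (fun q : ℝ => D / q ^ 2 - Real.pi * (q ^ 2 - 1)) (𝓝[>] 1) (𝓝 D) := by
    have : ContinuousAt (fun q : ℝ => D / q ^ 2 - Real.pi * (q ^ 2 - 1)) 1 := by
      fun_prop (disch := norm_num)
    have h := this.tendsto
    norm_num at h
    exact h.mono_left nhdsWithin_le_nhds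
  have hpos : ∀ᶠ q : ℝ in 𝓝[>] 1, 0 < D / q ^ 2 - Real.pi * (q ^ 2 - 1) :=
    hlim.eventually (lt_mem_nhds hD0)
  have hbd : ∀ᶠ q : ℝ in 𝓝[>] 1, q ∈ Ioo (1 : ℝ) 2 := Ioo_mem_nhdsGT (by norm_num)
  have hT : Tendsto (fun q : ℝ => ∫⁻ y : EuclideanSpace ℝ (Fin 2), ENNReal.ofReal (Real.exp
      (-(lam * p * (D / q ^ 2 - Real.pi * (q ^ 2 - 1)) * (‖y‖ / q) ^ 2) -
        g * (δ * (‖y‖ / q) ^ α)))) (𝓝[>] 1)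
      (𝓝 (∫⁻ y : EuclideanSpace ℝ (Fin 2), ENNReal.ofReal (Real.exp
        (-(lam * p * D * ‖y‖ ^ 2) - g * (δ * ‖y‖ ^ α))))) := by
    refine tendsto_lintegral_filter_of_dominated_convergence
      (fun y => ENNReal.ofReal (Real.exp (-(g * δ / 2 ^ α) * ‖y‖ ^ α)))
      (Eventually.of_forall fun q => by fun_prop) ?_ ?_ ?_
    · filter_upwards [hpos, hbd] with q hq hq'
      have hq0 : 0 < q := by linarith [hq'.1]
      refine Eventually.of_forall fun y => ENNReal.ofReal_le_ofReal (Real.exp_le_exp.mpr ?_)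
      have h1 : 0 ≤ lam * p * (D / q ^ 2 - Real.pi * (q ^ 2 - 1)) * (‖y‖ / q) ^ 2 := by positivity
      have h2 : (‖y‖ / 2) ^ α ≤ (‖y‖ / q) ^ α := by
        have := hq'.2.le
        gcongr
      rw [Real.div_rpow (norm_nonneg _) (by norm_num)] at h2
      have h3 : g * δ * (‖y‖ ^ α / 2 ^ α) ≤ g * δ * (‖y‖ / q) ^ α := by gcongr
      have h4 : -(g * δ / 2 ^ α) * ‖y‖ ^ α = -(g * δ * (‖y‖ ^ α / 2 ^ α)) := by ring
      rw [h4]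
      linarith
    · rw [lintegral_exp_neg_mul_norm_rpow hα0 (by positivity)]
      exact ENNReal.ofReal_ne_top
    · refine Eventually.of_forall fun y => ENNReal.tendsto_ofReal
        ((Real.continuous_exp.tendsto _).comp ?_)
      have h1 : Tendsto (fun q : ℝ => ‖y‖ / q) (𝓝[>] 1) (𝓝 ‖y‖) := by
        have : ContinuousAt (fun q : ℝ => ‖y‖ / q) 1 := by fun_prop (disch := norm_num)
        have h := this.tendsto
        rw [div_one] at h
        exact h.mono_left nhdsWithin_le_nhds
      exact ((hlim.const_mul _).mul (h1.pow 2)).neg.sub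
        (((h1.rpow_const (Or.inr hα0.le)).const_mul δ).const_mul g)
  have e : lam * p * ((2 / α) * Real.pi ^ 2 / Real.sin ((2 / α) * Real.pi)) * δ ^ (2 / α) =
      lam * p * D := by rw [hD]; ring
  rw [e]
  refine ge_of_tendsto (ENNReal.Tendsto.const_mul hT
    (Or.inr (ENNReal.mul_ne_top hK ENNReal.ofReal_ne_top))) ?_
  filter_upwards [hpos, hbd] with q hq hq'
  exact tsum_lintegral_le_of_one_lt hx hPP hlam hp0 hp1 hα hδ hg.le hK hRm hR0 hR hq'.1 rfl
    (by positivity)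

end

/-! ### Reception in one frame: fading and transmission -/

namespace Network

section Measurability

variable {Ω : Type*} [MeasurableSpace Ω] {W : Network Ω}

lemma measurable_gain (hpos : ∀ i, Measurable (W.pos i)) (hfade : ∀ i, Measurable (W.fade i))
    (α : ℝ) (i : ℕ) : Measurable (W.gain α i) := by
  have h1 := hpos i
  have h2 := hfade i
  unfold gain
  fun_prop

lemma measurableSet_isNeighbor (hpos : ∀ i, Measurable (W.pos i))
    (hfade : ∀ i, Measurable (W.fade i)) (α θ : ℝ) (i : ℕ) :
    MeasurableSet {ω | W.IsNeighbor α θ i ω} :=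
  measurableSet_le measurable_const (measurable_gain hpos hfade α i)

lemma measurable_interference (hpos : ∀ i, Measurable (W.pos i))
    (hfade : ∀ i, Measurable (W.fade i)) (htx : ∀ v m, Measurable (W.tx v m))
    (α : ℝ) (i m : ℕ) : Measurable (W.interference α i m) := by
  unfold interference
  refine Measurable.tsum fun j => Measurable.ite ?_
    (measurable_gain hpos hfade α j).ennreal_ofReal measurable_const
  exact (MeasurableSet.const _).inter (htx (some j) m (measurableSet_singleton true))

lemma measurableSet_receives (hpos : ∀ i, Measurable (W.pos i))
    (hfade : ∀ i, Measurable (W.fade i)) (htx : ∀ v m, Measurable (W.tx v m))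
    (α γ δ : ℝ) (i m : ℕ) : MeasurableSet {ω | W.Receives α γ δ i m ω} := by
  have h1 := measurable_interference hpos hfade htx α i m
  have h2 := measurable_gain hpos hfade α i
  have h3 : Measurable (W.sinr α γ i m) := by
    unfold sinr
    fun_prop
  exact (htx (some i) m (measurableSet_singleton true)).inter
    ((htx none m (measurableSet_singleton false)).inter (measurableSet_le measurable_const h3))

end Measurability

/-- The network in one frame, on the space of positions, fading gains and sets of transmitting
nodes; the frame index is ignored. -/
def snapshot :
    Network (((ℕ → EuclideanSpace ℝ (Fin 2)) × (ℕ → ℝ)) × (Option ℕ → Bool)) where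
  pos i z := z.1.1 i
  fade i z := z.1.2 i
  tx v _ z := z.2 v

lemma measurableSet_snapshot_receives (α γ δ : ℝ) (i : ℕ) :
    MeasurableSet {z | snapshot.Receives α γ δ i 0 z} := by
  refine measurableSet_receives ?_ ?_ ?_ α γ δ i 0 <;>
  · intros
    simp only [snapshot]
    fun_prop

lemma not_snapshot_receives_of_eq_zero {α γ δ : ℝ} (hα : 0 < α) (hδ : 0 < δ) {i : ℕ}
    {x : ℕ → EuclideanSpace ℝ (Fin 2)} (hx : x i = 0) (g : ℕ → ℝ) (t : Option ℕ → Bool) :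
    ¬ snapshot.Receives α γ δ i 0 ((x, g), t) := by
  rintro ⟨-, -, h⟩
  simp [sinr, gain, snapshot, hx, Real.zero_rpow (neg_ne_zero.mpr hα.ne')] at h
  linarith

/-- Reception forces the fading gain of the sender to be at least an affine function of the gains of
any finite set of transmitting nodes. -/
lemma le_fade_of_snapshot_receives {α γ δ : ℝ} (hγ : 0 < γ) (hδ : 0 < δ) {i : ℕ}
    {x : ℕ → EuclideanSpace ℝ (Fin 2)} (hx : x i ≠ 0) {g : ℕ → ℝ} {t : Option ℕ → Bool}
    (h : snapshot.Receives α γ δ i 0 ((x, g), t)) (S : Finset ℕ) (hi : i ∉ S)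
    (hS : ∀ j ∈ S, t (some j) = true) :
    1 / γ * (δ * ‖x i‖ ^ α) + ∑ j ∈ S, δ * ‖x i‖ ^ α * ‖x j‖ ^ (-α) * g j ≤ g i := by
  classical
  have h1 := ENNReal.mul_le_of_le_div h.2.2
  set s : ℝ := ∑ j ∈ S, max (g j * ‖x j‖ ^ (-α)) 0 with hs
  have hs0 : 0 ≤ s := Finset.sum_nonneg fun j _ => le_max_right _ _
  have hI : ENNReal.ofReal s ≤ snapshot.interference α i 0 ((x, g), t) := by
    rw [hs, ENNReal.ofReal_sum_of_nonneg (fun j _ => le_max_right _ _)]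
    unfold interference
    refine le_trans (Finset.sum_le_sum fun j hj => ?_) (ENNReal.sum_le_tsum S)
    have : j ≠ i ∧ snapshot.tx (some j) 0 ((x, g), t) = true := ⟨fun e => hi (e ▸ hj), hS j hj⟩
    rw [if_pos this, ENNReal.ofReal_max]
    simp [gain, snapshot]
  have h2 : ENNReal.ofReal (δ * (γ * s + 1)) ≤
      ENNReal.ofReal (γ * (g i * ‖x i‖ ^ (-α))) := by
    refine le_trans (le_of_eq ?_) ((mul_le_mul_right (add_le_add_left
      (mul_le_mul_right hI (ENNReal.ofReal γ)) 1) (ENNReal.ofReal δ)).trans h1)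
    rw [ENNReal.ofReal_mul hδ.le, ENNReal.ofReal_add (by positivity) zero_le_one,
      ENNReal.ofReal_mul hγ.le, ENNReal.ofReal_one]
  have h3 : δ * (γ * s + 1) ≤ γ * (g i * ‖x i‖ ^ (-α)) := by
    rcases ENNReal.ofReal_le_ofReal_iff'.mp h2 with h | h
    · exact h
    · have : 0 < δ * (γ * s + 1) := by positivity
      linarith
  have hr : 0 < ‖x i‖ ^ α := Real.rpow_pos_of_pos (norm_pos_iff.mpr hx) _
  rw [Real.rpow_neg (norm_nonneg (x i))] at h3
  have h4 : ∑ j ∈ S, δ * ‖x i‖ ^ α * ‖x j‖ ^ (-α) * g j ≤ δ * ‖x i‖ ^ α * s := by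
    rw [hs, Finset.mul_sum]
    refine Finset.sum_le_sum fun j _ => ?_
    rw [mul_assoc _ (‖x j‖ ^ (-α)), mul_comm (‖x j‖ ^ (-α))]
    exact mul_le_mul_of_nonneg_left (le_max_left _ _) (by positivity)
  have h5 : g i = (γ * (g i * (‖x i‖ ^ α)⁻¹)) * (‖x i‖ ^ α / γ) := by field_simp
  have h6 : 1 / γ * (δ * ‖x i‖ ^ α) + δ * ‖x i‖ ^ α * s = δ * (γ * s + 1) * (‖x i‖ ^ α / γ) := by
    field_simp
    ring
  rw [h5]
  refine le_trans (add_le_add_right h4 _) ?_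
  rw [h6]
  exact mul_le_mul_of_nonneg_right h3 (by positivity)

end Network

section Fading

lemma lintegral_exp_neg_mul_expMeasure {c : ℝ} (hc : 0 ≤ c) :
    ∫⁻ x, ENNReal.ofReal (Real.exp (-(c * x))) ∂(expMeasure 1) = ENNReal.ofReal (1 / (1 + c)) := by
  have h : expMeasure 1 = volume.withDensity (exponentialPDF 1) := rfl
  rw [h, lintegral_withDensity_eq_lintegral_mul _ (by unfold exponentialPDF; fun_prop)
    (by fun_prop), ofReal_inv_one_add_eq_lintegral hc, ← lintegral_indicator measurableSet_Ioi]
  refine lintegral_congr_ae ?_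
  have h0 : ∀ᵐ x : ℝ, x ≠ 0 := compl_mem_ae_iff.mpr (measure_singleton _)
  filter_upwards [h0] with x hx
  simp only [Pi.mul_apply, exponentialPDF_eq]
  by_cases h1 : 0 < x
  · rw [indicator_of_mem (by exact h1), if_pos h1.le, ← ENNReal.ofReal_mul (by positivity)]
    congr 1
    rw [one_mul, one_mul, ← Real.exp_add]
    congr 1; ring
  · rw [indicator_of_notMem (by exact h1), if_neg]
    · simp
    · intro h2; exact h1 (lt_of_le_of_ne h2 hx.symm)

lemma expMeasure_Ici {u : ℝ} (hu : 0 ≤ u) :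
    expMeasure 1 (Ici u) = ENNReal.ofReal (Real.exp (-u)) := by
  have h : expMeasure 1 = volume.withDensity (exponentialPDF 1) := rfl
  rw [h, withDensity_apply _ measurableSet_Ici, ← integral_exp_neg_Ioi u,
    ofReal_integral_eq_lintegral_ofReal (by simpa [IntegrableOn] using integrableOn_exp_neg_Ioi u)
      (Eventually.of_forall fun x => (Real.exp_pos _).le),
    ← setLIntegral_congr Ioi_ae_eq_Ici]
  refine setLIntegral_congr_fun measurableSet_Ioi fun x hx => ?_
  rw [exponentialPDF_of_nonneg (hu.trans (le_of_lt hx)), one_mul, one_mul]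

/-- The bound holds for negative `u` as well, where its right-hand side is at least one. -/
lemma expMeasure_Ici_le (u : ℝ) : expMeasure 1 (Ici u) ≤ ENNReal.ofReal (Real.exp (-u)) := by
  rcases le_or_gt 0 u with hu | hu
  · exact (expMeasure_Ici hu).le
  · have := isProbabilityMeasure_expMeasure one_pos
    refine prob_le_one.trans ?_
    rw [← ENNReal.ofReal_one]
    exact ENNReal.ofReal_le_ofReal (Real.one_le_exp (by linarith))

variable {Ω : Type*} [MeasurableSpace Ω] {P : Measure Ω}

/-- Rayleigh fading turns the distribution function of the signal into the Laplace transform of the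
interference: the tail of `G i` is exponential, and the other gains are independent. -/
lemma measure_add_sum_le_exponential {G : ℕ → Ω → ℝ} (hGm : ∀ i, Measurable (G i))
    (hG : ∀ i, HasLaw (G i) (expMeasure 1) P) (hind : iIndepFun G P)
    (i : ℕ) (S : Finset ℕ) (hi : i ∉ S) (a : ℝ) (c : ℕ → ℝ) (hc : ∀ j, 0 ≤ c j) :
    P {ω | a + ∑ j ∈ S, c j * G j ω ≤ G i ω} ≤
      ENNReal.ofReal (Real.exp (-a)) * ∏ j ∈ S, ENNReal.ofReal (1 / (1 + c j)) := by
  have := hind.isProbabilityMeasure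
  set Y : Ω → ℝ := fun ω => ∑ j ∈ S, c j * G j ω with hY
  have hYm : Measurable Y := by
    have := hGm
    fun_prop
  have hindep : IndepFun Y (G i) P := by
    have h := hind.indepFun_finset S {i} (Finset.disjoint_singleton_right.mpr hi) hGm
    have hφ : Measurable fun y : S → ℝ => ∑ j : S, c j * y j := by fun_prop
    have hψ : Measurable fun y : ({i} : Finset ℕ) → ℝ => y ⟨i, Finset.mem_singleton_self i⟩ :=
      measurable_pi_apply _
    have h2 := h.comp hφ hψ
    have e : Y = (fun y : S → ℝ => ∑ j : S, c j * y j) ∘ fun ω (j : S) => G j ω := by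
      ext ω
      simp only [hY, Function.comp]
      exact (Finset.sum_coe_sort S fun j => c j * G j ω).symm
    rw [e]
    exact h2
  have hmap := (indepFun_iff_map_prod_eq_prod_map_map hYm.aemeasurable
    (hGm i).aemeasurable).mp hindep
  have hset : MeasurableSet {z : ℝ × ℝ | a + z.1 ≤ z.2} :=
    measurableSet_le (by fun_prop) (by fun_prop)
  calc P {ω | a + Y ω ≤ G i ω}
      = (P.map fun ω => (Y ω, G i ω)) {z : ℝ × ℝ | a + z.1 ≤ z.2} := by
        rw [Measure.map_apply (hYm.prodMk (hGm i)) hset]; rfl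
    _ = ∫⁻ y, expMeasure 1 (Ici (a + y)) ∂(P.map Y) := by
        have := isProbabilityMeasure_expMeasure one_pos
        rw [hmap, (hG i).map_eq, Measure.prod_apply hset]
        rfl
    _ ≤ ∫⁻ y, ENNReal.ofReal (Real.exp (-(a + y))) ∂(P.map Y) :=
        lintegral_mono fun y => expMeasure_Ici_le _
    _ = ∫⁻ ω, ENNReal.ofReal (Real.exp (-a)) *
          ∏ j ∈ S, ENNReal.ofReal (Real.exp (-(c j * G j ω))) ∂P := by
        rw [lintegral_map (by fun_prop) hYm]
        refine lintegral_congr fun ω => ?_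
        rw [neg_add, Real.exp_add, ENNReal.ofReal_mul (Real.exp_pos _).le, hY,
          ← Finset.sum_neg_distrib, Real.exp_sum,
          ENNReal.ofReal_prod_of_nonneg fun _ _ => (Real.exp_pos _).le]
    _ = _ := by
        have h1 := lintegral_prod_eq_prod_lintegral_of_indepFun S _
          (hind.comp (fun j y => ENNReal.ofReal (Real.exp (-(c j * y)))) (fun j => by fun_prop))
          (fun j => by have := hGm j; fun_prop)
        simp only [Function.comp] at h1
        rw [lintegral_const_mul _ (Finset.measurable_prod _ fun j _ => by
          have := hGm j; fun_prop), h1]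
        congr 1
        refine Finset.prod_congr rfl fun j _ => ?_
        rw [← lintegral_exp_neg_mul_expMeasure (hc j)]
        exact (hG j).lintegral_comp (f := fun y => ENNReal.ofReal (Real.exp (-(c j * y))))
          (by fun_prop)

end Fading

section Transmission

variable {Ω : Type*} [MeasurableSpace Ω] {P : Measure Ω} [IsProbabilityMeasure P]

lemma lintegral_comp_bool {T : Ω → Bool} (hT : Measurable T) {p : ℝ} (hp : 0 ≤ p)
    (hTp : P {ω | T ω = true} = ENNReal.ofReal p) (f : Bool → ℝ≥0∞) :
    ∫⁻ ω, f (T ω) ∂P = ENNReal.ofReal p * f true + ENNReal.ofReal (1 - p) * f false := by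
  have h1 : P {ω | T ω = false} = ENNReal.ofReal (1 - p) := by
    have h2 : {ω | T ω = false} = {ω | T ω = true}ᶜ := by ext; simp
    have h3 : MeasurableSet {ω | T ω = true} := hT (measurableSet_singleton true)
    rw [h2, prob_compl_eq_one_sub h3, hTp,
      ENNReal.ofReal_sub _ hp, ENNReal.ofReal_one]
  rw [← lintegral_map (f := f) (by fun_prop) hT, lintegral_fintype]
  rw [Fintype.sum_bool, Measure.map_apply hT (measurableSet_singleton _),
    Measure.map_apply hT (measurableSet_singleton _)]
  have e1 : T ⁻¹' {true} = {ω | T ω = true} := rfl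
  have e2 : T ⁻¹' {false} = {ω | T ω = false} := rfl
  rw [e1, e2, hTp, h1, mul_comm, mul_comm (f false)]

/-- The typical node listens, node `i` transmits, and every transmitting node `j` of `S` contributes
the factor `1 / (1 + c j)`. -/
lemma lintegral_transmission {T : Option ℕ → Ω → Bool} (hT : ∀ v, Measurable (T v))
    (hind : iIndepFun T P) {p : ℝ} (hp0 : 0 ≤ p) (hp1 : p ≤ 1)
    (hTp : ∀ v, P {ω | T v ω = true} = ENNReal.ofReal p)
    (i : ℕ) (S : Finset ℕ) (hi : i ∉ S) (c : ℕ → ℝ) (hc : ∀ j, 0 ≤ c j) :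
    ∫⁻ ω, (if T none ω then 0 else 1) * ((if T (some i) ω then 1 else 0) *
      ∏ j ∈ S, if T (some j) ω then ENNReal.ofReal (1 / (1 + c j)) else 1) ∂P =
      ENNReal.ofReal (p * (1 - p)) * ENNReal.ofReal (∏ j ∈ S, (1 - p + p * (1 / (1 + c j)))) := by
  let h : Option ℕ → Bool → ℝ≥0∞ := fun v t => v.elim (if t then 0 else 1) fun j =>
    if j = i then (if t then 1 else 0) else (if t then ENNReal.ofReal (1 / (1 + c j)) else 1)
  have h1 := lintegral_prod_eq_prod_lintegral_of_indepFun (insert i S).insertNone _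
    (hind.comp h (fun v => by fun_prop)) (fun v => (by fun_prop : Measurable (h v)).comp (hT v))
  simp only [Function.comp, Finset.prod_insertNone, Finset.prod_insert hi] at h1
  have hne : ∀ j ∈ S, j ≠ i := fun j hj e => hi (e ▸ hj)
  have h2 : ∀ ω, h none (T none ω) * (h (some i) (T (some i) ω) *
      ∏ j ∈ S, h (some j) (T (some j) ω)) = (if T none ω then 0 else 1) *
      ((if T (some i) ω then 1 else 0) *
      ∏ j ∈ S, if T (some j) ω then ENNReal.ofReal (1 / (1 + c j)) else 1) := by
    intro ω
    simp only [h, Option.elim, if_true]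
    congr 2
    exact Finset.prod_congr rfl fun j hj => by rw [if_neg (hne j hj)]
  simp_rw [h2] at h1
  rw [h1]
  simp_rw [fun v => lintegral_comp_bool (hT v) hp0 (hTp v) (h v)]
  have h3 : ∏ j ∈ S, (ENNReal.ofReal p * h (some j) true + ENNReal.ofReal (1 - p) *
      h (some j) false) = ENNReal.ofReal (∏ j ∈ S, (1 - p + p * (1 / (1 + c j)))) := by
    have hpp : 0 ≤ 1 - p := by linarith
    have hcc : ∀ j, 0 ≤ 1 / (1 + c j) := fun j => by have := hc j; positivity
    rw [ENNReal.ofReal_prod_of_nonneg fun j _ => add_nonneg hpp (mul_nonneg hp0 (hcc j))]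
    refine Finset.prod_congr rfl fun j hj => ?_
    simp only [h, Option.elim, if_neg (hne j hj), if_true]
    rw [add_comm, ENNReal.ofReal_add hpp (mul_nonneg hp0 (hcc j)), ENNReal.ofReal_mul hp0]
    simp
  rw [h3, ENNReal.ofReal_mul hp0]
  simp [h]
  ring

end Transmission

/-! ### Conditioning and Jensen's inequality -/

/-- Tangent-line inequality for the convex function `u ↦ u ^ n` on `[0, ∞)`. -/
lemma pow_add_mul_sub_le_pow {u v : ℝ} (hu : 0 ≤ u) (hv : 0 ≤ v) (n : ℕ) :
    v ^ n + n * v ^ (n - 1) * (u - v) ≤ u ^ n := by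
  rcases n with _ | n
  · simp
  simp only [Nat.add_sub_cancel]
  induction n with
  | zero => simp
  | succ n ih =>
    have h1 := mul_le_mul_of_nonneg_left ih hu
    have h2 : 0 ≤ ((n : ℝ) + 1) * v ^ n * (u - v) ^ 2 := by positivity
    push_cast at h1 ⊢
    have e1 : u ^ (n + 1 + 1) = u * u ^ (n + 1) := by ring
    rw [e1]
    refine le_trans (le_of_eq ?_) (le_trans (sub_le_self _ h2) h1)
    ring

/-- Jensen's inequality for `u ↦ u ^ n` with respect to the (unnormalized) Palm distribution, by
integration of the tangent line at `1 - c`, where `c` bounds the mean of `r`. -/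
lemma pow_mul_le_tsum_lintegral {Ω : Type*} [MeasurableSpace Ω] {P : Measure Ω}
    {N : ℕ → Set Ω} {r : ℕ → Ω → ℝ≥0∞}
    (hr : ∀ i, Measurable (r i)) (hr1 : ∀ i ω, r i ω ≤ 1) {M : ℝ≥0∞} (hM : ∑' i, P (N i) = M)
    (hMtop : M ≠ ∞) {c : ℝ} (hc0 : 0 ≤ c)
    (hle : ∑' i, ∫⁻ ω, r i ω ∂P ≤ ENNReal.ofReal c * M) (n : ℕ) :
    ENNReal.ofReal (max 0 (1 - c) ^ n) * M ≤
      ∑' i, ∫⁻ ω in N i, (1 - r i ω) ^ n ∂P := by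
  -- for `1 < c` the left-hand side vanishes, unless `n = 0`
  by_cases hc1 : c ≤ 1
  swap
  · rcases n with _ | n
    · simp only [pow_zero, ENNReal.ofReal_one, one_mul, lintegral_const,
        Measure.restrict_apply_univ]
      rw [hM]
    · rw [max_eq_left (by linarith), zero_pow n.succ_ne_zero, ENNReal.ofReal_zero, zero_mul]
      exact bot_le
  rw [max_eq_right (by linarith)]
  set A : ℝ := (1 - c) ^ n with hA
  set B : ℝ := n * (1 - c) ^ (n - 1) with hB
  have hv : 0 ≤ 1 - c := by linarith
  have hA0 : 0 ≤ A := by positivity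
  have hB0 : 0 ≤ B := by positivity
  have hpt : ∀ i ω, ENNReal.ofReal A + ENNReal.ofReal (B * c) ≤
      (1 - r i ω) ^ n + ENNReal.ofReal B * r i ω := by
    intro i ω
    have hfin : r i ω ≠ ∞ := ((hr1 i ω).trans_lt ENNReal.one_lt_top).ne
    obtain ⟨ρ, hρ⟩ : ∃ ρ, (r i ω).toReal = ρ := ⟨_, rfl⟩
    have hρ0 : 0 ≤ ρ := hρ ▸ ENNReal.toReal_nonneg
    have hρ1 : ρ ≤ 1 := by
      rw [← hρ]; exact ENNReal.toReal_le_of_le_ofReal zero_le_one (by simpa using hr1 i ω)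
    rw [← ENNReal.ofReal_toReal hfin, hρ, ← ENNReal.ofReal_one, ← ENNReal.ofReal_sub _ hρ0,
      ← ENNReal.ofReal_pow (by linarith), ← ENNReal.ofReal_mul hB0,
      ← ENNReal.ofReal_add hA0 (by positivity), ← ENNReal.ofReal_add
        (pow_nonneg (by linarith) n) (by positivity)]
    refine ENNReal.ofReal_le_ofReal ?_
    have := pow_add_mul_sub_le_pow (u := 1 - ρ) (v := 1 - c) (by linarith) hv n
    nlinarith
  have h1 : ENNReal.ofReal A * M + ENNReal.ofReal (B * c) * M ≤
      (∑' i, ∫⁻ ω in N i, (1 - r i ω) ^ n ∂P) + ENNReal.ofReal (B * c) * M := by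
    calc ENNReal.ofReal A * M + ENNReal.ofReal (B * c) * M
        = ∑' i, ∫⁻ ω in N i, (ENNReal.ofReal A + ENNReal.ofReal (B * c)) ∂P := by
          simp only [lintegral_const, Measure.restrict_apply_univ]
          rw [ENNReal.tsum_mul_left, hM, add_mul]
      _ ≤ ∑' i, ∫⁻ ω in N i, ((1 - r i ω) ^ n + ENNReal.ofReal B * r i ω) ∂P :=
          ENNReal.tsum_le_tsum fun i => lintegral_mono fun ω => hpt i ω
      _ = (∑' i, ∫⁻ ω in N i, (1 - r i ω) ^ n ∂P) +
            ENNReal.ofReal B * ∑' i, ∫⁻ ω in N i, r i ω ∂P := by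
          rw [← ENNReal.tsum_mul_left, ← ENNReal.tsum_add]
          refine tsum_congr fun i => ?_
          rw [lintegral_add_right _ ((hr i).const_mul _), lintegral_const_mul _ (hr i)]
      _ ≤ _ := by
          rw [ENNReal.ofReal_mul hB0, mul_assoc]
          gcongr
          refine le_trans (ENNReal.tsum_le_tsum fun i => ?_) hle
          exact lintegral_mono' Measure.restrict_le_self le_rfl
  exact (ENNReal.add_le_add_iff_right
    (ENNReal.mul_ne_top ENNReal.ofReal_ne_top hMtop)).mp h1

namespace Network

variable {Ω : Type*} [MeasurableSpace Ω] {P : Measure Ω} {W : Network Ω} {lam p : ℝ}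

/-- Given the positions and fading gains `z`, the probability that the typical node receives the
message of node `i` in a given frame. The frame `0` is used; all frames have the same law. -/
def receptionProb (W : Network Ω) (P : Measure Ω) (α γ δ : ℝ) (i : ℕ)
    (z : (ℕ → EuclideanSpace ℝ (Fin 2)) × (ℕ → ℝ)) : ℝ≥0∞ :=
  (P.map fun ω v => W.tx v 0 ω) {t | snapshot.Receives α γ δ i 0 (z, t)}

namespace IsPoissonAloha

variable (hW : W.IsPoissonAloha P lam p)
include hW

lemma measurable_tx_frame (m : ℕ) : Measurable fun ω v => W.tx v m ω :=
  measurable_pi_lambda _ fun v => hW.measurable_tx v m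

lemma measurable_pos_pi : Measurable fun ω i => W.pos i ω :=
  measurable_pi_lambda _ hW.measurable_pos

lemma measurable_fade_pi : Measurable fun ω i => W.fade i ω :=
  measurable_pi_lambda _ hW.measurable_fade

lemma measurable_pos_fade : Measurable fun ω => ((fun i => W.pos i ω), (fun i => W.fade i ω)) :=
  hW.measurable_pos_pi.prodMk hW.measurable_fade_pi

variable [IsProbabilityMeasure P]

lemma measurable_receptionProb (α γ δ : ℝ) (i : ℕ) :
    Measurable (W.receptionProb P α γ δ i) := by
  have := Measure.isProbabilityMeasure_map (μ := P) (hW.measurable_tx_frame 0).aemeasurable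
  exact measurable_measure_prodMk_left (measurableSet_snapshot_receives α γ δ i)

lemma receptionProb_le_one (α γ δ : ℝ) (i : ℕ)
    (z : (ℕ → EuclideanSpace ℝ (Fin 2)) × (ℕ → ℝ)) : W.receptionProb P α γ δ i z ≤ 1 := by
  have := Measure.isProbabilityMeasure_map (μ := P) (hW.measurable_tx_frame 0).aemeasurable
  exact prob_le_one

lemma map_pos_fade : P.map (fun ω => ((fun i => W.pos i ω), (fun i => W.fade i ω))) =
    (P.map fun ω i => W.pos i ω).prod (P.map fun ω i => W.fade i ω) :=
  (indepFun_iff_map_prod_eq_prod_map_map hW.measurable_pos_pi.aemeasurable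
    hW.measurable_fade_pi.aemeasurable).mp hW.indep_pos_fade

/-- For fixed positions, the fading gains are integrated first, given who transmits, and then the
transmissions. -/
lemma lintegral_receptionProb_le (hp0 : 0 ≤ p) (hp1 : p ≤ 1) {α γ δ : ℝ} (hα : 0 < α)
    (hγ : 0 < γ) (hδ : 0 < δ) (i : ℕ) (x : ℕ → EuclideanSpace ℝ (Fin 2)) (S : Finset ℕ)
    (hi : i ∉ S) :
    ∫⁻ g, W.receptionProb P α γ δ i (x, g) ∂(P.map fun ω i => W.fade i ω) ≤
      ENNReal.ofReal (p * (1 - p)) * ENNReal.ofReal (Real.exp (-(1 / γ * (δ * ‖x i‖ ^ α)))) *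
        ENNReal.ofReal (∏ j ∈ S, laplaceFactor p δ α ‖x i‖ ‖x j‖) := by
  have := Measure.isProbabilityMeasure_map (μ := P) (hW.measurable_tx_frame 0).aemeasurable
  have := Measure.isProbabilityMeasure_map (μ := P) hW.measurable_fade_pi.aemeasurable
  rcases eq_or_ne (x i) 0 with hx | hx
  · have : ∀ g, W.receptionProb P α γ δ i (x, g) = 0 := by
      intro g
      have : {t | snapshot.Receives α γ δ i 0 ((x, g), t)} = ∅ := by
        ext t; simp [not_snapshot_receives_of_eq_zero hα hδ hx g t]
      rw [receptionProb, this, measure_empty]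
    simp [this]
  set c : ℕ → ℝ := fun j => δ * ‖x i‖ ^ α * ‖x j‖ ^ (-α) with hc
  have hc0 : ∀ j, 0 ≤ c j := fun j => by positivity
  set a : ℝ := 1 / γ * (δ * ‖x i‖ ^ α) with ha
  have hD : MeasurableSet {z : (ℕ → ℝ) × (Option ℕ → Bool) |
      snapshot.Receives α γ δ i 0 ((x, z.1), z.2)} := by
    have hm : Measurable fun z : (ℕ → ℝ) × (Option ℕ → Bool) => ((x, z.1), z.2) := by fun_prop
    exact hm (measurableSet_snapshot_receives α γ δ i)
  have hfade : ∀ t : Option ℕ → Bool, (P.map fun ω i => W.fade i ω)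
      {g | snapshot.Receives α γ δ i 0 ((x, g), t)} ≤ ENNReal.ofReal (Real.exp (-a)) *
      ((if t none then 0 else 1) * ((if t (some i) then 1 else 0) *
        ∏ j ∈ S, if t (some j) then ENNReal.ofReal (1 / (1 + c j)) else 1)) := by
    intro t
    by_cases h1 : t none = true
    · have : {g | snapshot.Receives α γ δ i 0 ((x, g), t)} = ∅ := by
        ext g
        simp only [mem_ofPred_eq, mem_empty_iff_false, iff_false]
        rintro ⟨-, h, -⟩
        exact absurd (h1.symm.trans h) (by simp)
      simp [this]
    by_cases h2 : t (some i) = true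
    · simp only [h1, h2, if_true, one_mul]
      rw [← Finset.prod_filter]
      have h3 := measure_add_sum_le_exponential hW.measurable_fade hW.fade_law hW.indep_fade i
        (S.filter fun j => t (some j) = true) (fun h => hi (Finset.mem_of_mem_filter i h)) a c hc0
      have hm : MeasurableSet {g : ℕ → ℝ | a + ∑ j ∈ S.filter (fun j => t (some j) = true),
          c j * g j ≤ g i} := measurableSet_le (by fun_prop) (by fun_prop)
      have h4 : {g | snapshot.Receives α γ δ i 0 ((x, g), t)} ⊆
          {g : ℕ → ℝ | a + ∑ j ∈ S.filter (fun j => t (some j) = true), c j * g j ≤ g i} :=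
        fun g hg => le_fade_of_snapshot_receives hγ hδ hx hg _
          (fun h => hi (Finset.mem_of_mem_filter i h)) fun j hj => (Finset.mem_filter.mp hj).2
      refine (measure_mono h4).trans ?_
      rw [Measure.map_apply hW.measurable_fade_pi hm]
      simpa using h3
    · have : {g | snapshot.Receives α γ δ i 0 ((x, g), t)} = ∅ := by
        ext g
        simp only [mem_ofPred_eq, mem_empty_iff_false, iff_false]
        rintro ⟨h, -, -⟩
        exact h2 h
      simp [this]
  have hmeas : Measurable fun t : Option ℕ → Bool => ((if t none then 0 else 1) *
      ((if t (some i) then 1 else 0) *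
        ∏ j ∈ S, if t (some j) then ENNReal.ofReal (1 / (1 + c j)) else 1) : ℝ≥0∞) := by
    have hb : ∀ (v : Option ℕ) (y z : ℝ≥0∞),
        Measurable fun t : Option ℕ → Bool => if t v then y else z := fun v y z =>
      Measurable.ite (measurableSet_eq_fun (measurable_pi_apply v) measurable_const)
        measurable_const measurable_const
    exact (hb _ _ _).mul ((hb _ _ _).mul (Finset.measurable_prod _ fun j _ => hb _ _ _))
  calc ∫⁻ g, W.receptionProb P α γ δ i (x, g) ∂(P.map fun ω i => W.fade i ω)
      = ((P.map fun ω i => W.fade i ω).prod (P.map fun ω v => W.tx v 0 ω))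
          {z | snapshot.Receives α γ δ i 0 ((x, z.1), z.2)} := by
        rw [Measure.prod_apply hD]; rfl
    _ = ∫⁻ t, (P.map fun ω i => W.fade i ω) {g | snapshot.Receives α γ δ i 0 ((x, g), t)}
          ∂(P.map fun ω v => W.tx v 0 ω) := by
        rw [Measure.prod_apply_symm hD]; rfl
    _ ≤ ∫⁻ t, ENNReal.ofReal (Real.exp (-a)) *
      ((if t none then 0 else 1) * ((if t (some i) then 1 else 0) *
        ∏ j ∈ S, if t (some j) then ENNReal.ofReal (1 / (1 + c j)) else 1))
          ∂(P.map fun ω v => W.tx v 0 ω) := lintegral_mono hfade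
    _ = ENNReal.ofReal (Real.exp (-a)) * (ENNReal.ofReal (p * (1 - p)) *
          ENNReal.ofReal (∏ j ∈ S, (1 - p + p * (1 / (1 + c j))))) := by
        rw [lintegral_const_mul _ hmeas, lintegral_map hmeas (hW.measurable_tx_frame 0)]
        congr 1
        have hind := hW.indep_tx.precomp (g := fun v : Option ℕ => (v, 0))
          (fun v w h => (Prod.ext_iff.mp h).1)
        exact lintegral_transmission (fun v => hW.measurable_tx v 0) hind hp0 hp1
          (fun v => hW.tx_law v 0) i S hi c hc0
    _ = _ := by
        rw [mul_left_comm, mul_assoc]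
        rfl

/-- The expected number of nodes received in one frame, neighbors or not. No threshold `θ` on
the gain enters. -/
lemma tsum_lintegral_receptionProb_le (hlam : 0 < lam) (hp0 : 0 ≤ p) (hp1 : p ≤ 1) {α γ δ : ℝ}
    (hα : 2 < α) (hγ : 0 < γ) (hδ : 0 < δ) :
    ∑' i, ∫⁻ ω, W.receptionProb P α γ δ i ((fun j => W.pos j ω), (fun j => W.fade j ω)) ∂P ≤
      ENNReal.ofReal (p * (1 - p)) * ENNReal.ofReal lam *
        ENNReal.ofReal (Real.pi * (2 / α) * δ ^ (-(2 / α)) * rotatedIntegral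
          (lam * p * ((2 / α) * Real.pi ^ 2 / Real.sin ((2 / α) * Real.pi))) (1 / γ) (2 / α)) := by
  have hα0 : 0 < α := by linarith
  have hs : 0 < Real.sin ((2 / α) * Real.pi) := Real.sin_pos_of_pos_of_lt_pi (by positivity)
    (by have := (div_lt_one hα0).mpr hα; nlinarith [Real.pi_pos])
  have := Measure.isProbabilityMeasure_map (μ := P) hW.measurable_fade_pi.aemeasurable
  have := Measure.isProbabilityMeasure_map (μ := P) hW.measurable_pos_pi.aemeasurable
  have hrm := hW.measurable_receptionProb α γ δ
  have hRm : ∀ i, Measurable fun x =>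
      ∫⁻ g, W.receptionProb P α γ δ i (x, g) ∂(P.map fun ω i => W.fade i ω) := fun i =>
    (hrm i).lintegral_prod_right'
  have hcond : ∀ i, ∫⁻ ω, W.receptionProb P α γ δ i
        ((fun j => W.pos j ω), (fun j => W.fade j ω)) ∂P =
      ∫⁻ ω, ∫⁻ g, W.receptionProb P α γ δ i ((fun j => W.pos j ω), g)
        ∂(P.map fun ω i => W.fade i ω) ∂P := by
    intro i
    rw [← lintegral_map (hrm i) hW.measurable_pos_fade, hW.map_pos_fade,
      lintegral_prod _ (hrm i).aemeasurable, ← lintegral_map (hRm i) hW.measurable_pos_pi]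
  simp_rw [hcond]
  rw [← lintegral_exp_neg_sq_sub_rpow hα hδ (by positivity) (by positivity)]
  refine tsum_lintegral_le (R := fun i x =>
    ∫⁻ g, W.receptionProb P α γ δ i (x, g) ∂(P.map fun ω i => W.fade i ω)) hW.measurable_pos
    hW.poisson hlam hp0 hp1 hα hδ (by positivity) ENNReal.ofReal_ne_top hRm ?_
    (fun i y S hi => hW.lintegral_receptionProb_le hp0 hp1 hα0 hγ hδ i y S hi)
  intro i y hy
  have : ∀ g, W.receptionProb P α γ δ i (y, g) = 0 := by
    intro g
    have : {t | snapshot.Receives α γ δ i 0 ((y, g), t)} = ∅ := by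
      ext t; simp [not_snapshot_receives_of_eq_zero hα0 hδ hy g t]
    rw [receptionProb, this, measure_empty]
  simp [this]

/-- The expected number of neighbors. -/
lemma tsum_measure_isNeighbor (hα0 : 0 < α) {θ : ℝ} (hθ : 0 < θ) :
    ∑' i, P {ω | W.IsNeighbor α θ i ω} = ENNReal.ofReal lam *
      ENNReal.ofReal (Real.pi * θ ^ (-(2 / α)) * ((2 / α) * Real.Gamma (2 / α))) := by
  have := isProbabilityMeasure_expMeasure one_pos
  have hD : MeasurableSet {z : EuclideanSpace ℝ (Fin 2) × ℝ | θ ≤ z.2 * ‖z.1‖ ^ (-α)} :=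
    measurableSet_le (by fun_prop) (by fun_prop)
  set f : EuclideanSpace ℝ (Fin 2) → ℝ≥0∞ := fun y => expMeasure 1 {g | θ ≤ g * ‖y‖ ^ (-α)} with hf
  have hfm : Measurable f := measurable_measure_prodMk_left hD
  have h1 : ∀ i, P {ω | W.IsNeighbor α θ i ω} = ∫⁻ ω, f (W.pos i ω) ∂P := by
    intro i
    have hind : IndepFun (W.pos i) (W.fade i) P :=
      hW.indep_pos_fade.comp (measurable_pi_apply i) (measurable_pi_apply i)
    have hmap := (indepFun_iff_map_prod_eq_prod_map_map (hW.measurable_pos i).aemeasurable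
      (hW.measurable_fade i).aemeasurable).mp hind
    rw [(hW.fade_law i).map_eq] at hmap
    have hm := (hW.measurable_pos i).prodMk (hW.measurable_fade i)
    calc P {ω | W.IsNeighbor α θ i ω}
        = (P.map fun ω => (W.pos i ω, W.fade i ω)) {z | θ ≤ z.2 * ‖z.1‖ ^ (-α)} := by
          rw [Measure.map_apply hm hD]; rfl
      _ = _ := by
          rw [hmap, Measure.prod_apply hD, ← lintegral_map hfm (hW.measurable_pos i)]
          rfl
  have : SigmaFinite (ENNReal.ofReal lam • volume : Measure (EuclideanSpace ℝ (Fin 2))) :=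
    inferInstanceAs (SigmaFinite (Real.toNNReal lam • volume))
  simp_rw [h1]
  rw [hW.poisson.tsum_lintegral_comp hW.measurable_pos hfm, lintegral_smul_measure,
    ← lintegral_exp_neg_mul_norm_rpow hα0 hθ, smul_eq_mul]
  congr 1
  have h0 : ∀ᵐ y : EuclideanSpace ℝ (Fin 2), y ≠ 0 := compl_mem_ae_iff.mpr (measure_singleton _)
  refine lintegral_congr_ae ?_
  filter_upwards [h0] with y hy
  have hr : 0 < ‖y‖ ^ α := Real.rpow_pos_of_pos (norm_pos_iff.mpr hy) _
  have hset : {g : ℝ | θ ≤ g * ‖y‖ ^ (-α)} = Ici (θ * ‖y‖ ^ α) := by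
    ext g
    rw [mem_ofPred_eq, mem_Ici, Real.rpow_neg (norm_nonneg y), ← div_eq_mul_inv, le_div_iff₀ hr]
  simp only [hf]
  rw [hset, expMeasure_Ici (by positivity), neg_mul]

lemma map_tx_eq (v v' : Option ℕ) (m m' : ℕ) : P.map (W.tx v m) = P.map (W.tx v' m') := by
  have h1 : ∀ v m, P.map (W.tx v m) {true} = ENNReal.ofReal p := by
    intro v m
    rw [Measure.map_apply (hW.measurable_tx v m) (measurableSet_singleton _)]
    exact hW.tx_law v m
  have hpr : ∀ v m, IsProbabilityMeasure (P.map (W.tx v m)) := fun v m =>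
    Measure.isProbabilityMeasure_map (hW.measurable_tx v m).aemeasurable
  refine Measure.ext_of_singleton fun t => ?_
  cases t
  · have h2 : ({false} : Set Bool) = {true}ᶜ := by ext t; cases t <;> simp
    have := hpr v m
    have := hpr v' m'
    rw [h2, prob_compl_eq_one_sub (measurableSet_singleton _),
      prob_compl_eq_one_sub (measurableSet_singleton _), h1, h1]
  · rw [h1, h1]

lemma map_tx_frame (m : ℕ) : (P.map fun ω v => W.tx v m ω) =
    Measure.infinitePi fun _ : Option ℕ => P.map (W.tx none 0) := by
  have hind := hW.indep_tx.precomp (g := fun v : Option ℕ => (v, m))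
    (fun v w h => (Prod.ext_iff.mp h).1)
  have := hind.map_fun_eq_infinitePi_map (fun v => hW.measurable_tx v m)
  rw [this]
  congr 1
  ext1 v
  exact hW.map_tx_eq _ _ _ _

lemma iIndepFun_tx_frame : iIndepFun (fun m ω v => W.tx v m ω) P := by
  have hpr : IsProbabilityMeasure (P.map (W.tx none 0)) :=
    Measure.isProbabilityMeasure_map (hW.measurable_tx _ _).aemeasurable
  have hind := hW.indep_tx.precomp (g := fun mv : ℕ × Option ℕ => (mv.2, mv.1))
    Prod.swap_injective
  have h1 := hind.map_fun_eq_infinitePi_map (fun mv : ℕ × Option ℕ => hW.measurable_tx mv.2 mv.1)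
  rw [iIndepFun_iff_map_fun_eq_infinitePi_map hW.measurable_tx_frame]
  simp_rw [hW.map_tx_frame]
  rw [← Measure.infinitePi_map_curry (fun (_ : ℕ) (_ : Option ℕ) => P.map (W.tx none 0))]
  have h2 : (fun mv : ℕ × Option ℕ => P.map (fun ω => W.tx mv.2 mv.1 ω)) =
      fun _ => P.map (W.tx none 0) := by ext1 mv; exact hW.map_tx_eq _ _ _ _
  have h3 : Measurable fun ω (mv : ℕ × Option ℕ) => W.tx mv.2 mv.1 ω :=
    measurable_pi_lambda _ fun mv => hW.measurable_tx mv.2 mv.1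
  rw [← h2, ← h1, Measure.map_map (MeasurableEquiv.measurable _) h3]
  rfl

/-- Given positions and fading gains, the frames are independent and identically distributed. -/
lemma measure_forall_not_receives (α γ δ : ℝ) (i Mf : ℕ)
    (z : (ℕ → EuclideanSpace ℝ (Fin 2)) × (ℕ → ℝ)) :
    P {ω | ∀ m < Mf, ¬ snapshot.Receives α γ δ i 0 (z, fun v => W.tx v m ω)} =
      (1 - W.receptionProb P α γ δ i z) ^ Mf := by
  have hm : MeasurableSet {t | snapshot.Receives α γ δ i 0 (z, t)} :=
    measurable_prodMk_left (measurableSet_snapshot_receives α γ δ i)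
  have h := hW.iIndepFun_tx_frame.measure_inter_preimage_eq_mul (Finset.range Mf)
    (sets := fun _ => {t | snapshot.Receives α γ δ i 0 (z, t)}ᶜ) (fun _ _ => hm.compl)
  have e : {ω | ∀ m < Mf, ¬ snapshot.Receives α γ δ i 0 (z, fun v => W.tx v m ω)} =
      ⋂ m ∈ Finset.range Mf, (fun ω v => W.tx v m ω) ⁻¹'
        {t | snapshot.Receives α γ δ i 0 (z, t)}ᶜ := by
    ext ω; simp
  rw [e, h]
  have h1 : ∀ m, P ((fun ω v => W.tx v m ω) ⁻¹' {t | snapshot.Receives α γ δ i 0 (z, t)}ᶜ) =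
      1 - W.receptionProb P α γ δ i z := by
    intro m
    have := Measure.isProbabilityMeasure_map (μ := P) (hW.measurable_tx_frame 0).aemeasurable
    rw [← Measure.map_apply (hW.measurable_tx_frame m) hm.compl, hW.map_tx_frame m,
      ← hW.map_tx_frame 0, prob_compl_eq_one_sub hm]
    rfl
  simp_rw [h1]
  simp

/-- Conditioning on positions and fading gains. -/
lemma measure_isNeighbor_and_fails (α θ γ δ : ℝ) (i Mf : ℕ) :
    P {ω | W.IsNeighbor α θ i ω ∧ W.Fails α γ δ Mf i ω} =
      ∫⁻ ω in {ω | W.IsNeighbor α θ i ω},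
        (1 - W.receptionProb P α γ δ i ((fun j => W.pos j ω), (fun j => W.fade j ω))) ^ Mf ∂P := by
  have htx : Measurable fun ω (vm : Option ℕ × ℕ) => W.tx vm.1 vm.2 ω :=
    measurable_pi_lambda _ fun vm => hW.measurable_tx vm.1 vm.2
  have := Measure.isProbabilityMeasure_map (μ := P) htx.aemeasurable
  have hmap := (indepFun_iff_map_prod_eq_prod_map_map hW.measurable_pos_fade.aemeasurable
    htx.aemeasurable).mp hW.indep_pos_fade_tx
  set A : Set ((ℕ → EuclideanSpace ℝ (Fin 2)) × (ℕ → ℝ)) := {z | θ ≤ z.2 i * ‖z.1 i‖ ^ (-α)}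
    with hA
  have hAm : MeasurableSet A := measurableSet_le (by fun_prop) (by fun_prop)
  set D : Set (((ℕ → EuclideanSpace ℝ (Fin 2)) × (ℕ → ℝ)) × (Option ℕ × ℕ → Bool)) :=
    {y | y.1 ∈ A ∧ ∀ m < Mf, ¬ snapshot.Receives α γ δ i 0 (y.1, fun v => y.2 (v, m))} with hD
  have hDm : MeasurableSet D := by
    refine (measurable_fst hAm).inter ?_
    refine MeasurableSet.congr (s := ⋂ m, ⋂ (_ : m < Mf), {y | snapshot.Receives α γ δ i 0
      (y.1, fun v => y.2 (v, m))}ᶜ) ?_ (by ext y; simp; rfl)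
    refine MeasurableSet.iInter fun m => MeasurableSet.iInter fun _ => ?_
    have hm : Measurable fun y : ((ℕ → EuclideanSpace ℝ (Fin 2)) × (ℕ → ℝ)) ×
        (Option ℕ × ℕ → Bool) => (y.1, fun v => y.2 (v, m)) := by fun_prop
    exact (hm (measurableSet_snapshot_receives α γ δ i)).compl
  have hr := (hW.measurable_receptionProb α γ δ i)
  have hrm : Measurable fun z => A.indicator
      (fun z => (1 - W.receptionProb P α γ δ i z) ^ Mf) z :=
    ((measurable_const.sub hr).pow_const Mf).indicator hAm
  calc P {ω | W.IsNeighbor α θ i ω ∧ W.Fails α γ δ Mf i ω}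
      = (P.map fun ω => (((fun i => W.pos i ω), (fun i => W.fade i ω)),
          fun vm : Option ℕ × ℕ => W.tx vm.1 vm.2 ω)) D := by
        rw [Measure.map_apply (hW.measurable_pos_fade.prodMk htx) hDm]; rfl
    _ = ∫⁻ z, A.indicator (fun z => (1 - W.receptionProb P α γ δ i z) ^ Mf) z
          ∂(P.map fun ω => ((fun i => W.pos i ω), (fun i => W.fade i ω))) := by
        rw [hmap, Measure.prod_apply hDm]
        refine lintegral_congr fun z => ?_
        rw [Measure.map_apply htx (measurable_prodMk_left hDm)]
        by_cases hz : z ∈ A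
        · rw [indicator_of_mem hz, ← hW.measure_forall_not_receives]
          congr 1
          ext ω
          simp [hD, hz]
        · rw [indicator_of_notMem hz]
          have : (fun ω (vm : Option ℕ × ℕ) => W.tx vm.1 vm.2 ω) ⁻¹' (Prod.mk z ⁻¹' D) = ∅ := by
            ext ω
            simp [hD, hz]
          rw [this, measure_empty]
    _ = _ := by
        rw [lintegral_map hrm hW.measurable_pos_fade, ← lintegral_indicator
          (measurableSet_isNeighbor hW.measurable_pos hW.measurable_fade α θ i)]
        rfl

end IsPoissonAloha

lemma lintegral_encard_eq_tsum {Q : ℕ → Ω → Prop} (hQ : ∀ i, MeasurableSet {ω | Q i ω}) :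
    ∫⁻ ω, ((Set.encard {i | Q i ω} : ℕ∞) : ℝ≥0∞) ∂P = ∑' i, P {ω | Q i ω} := by
  have h1 : ∀ ω, ((Set.encard {i | Q i ω} : ℕ∞) : ℝ≥0∞) =
      ∑' i, {ω | Q i ω}.indicator (fun _ => (1 : ℝ≥0∞)) ω := by
    intro ω
    rw [← ENNReal.tsum_set_one, tsum_subtype {i | Q i ω} (fun _ => (1 : ℝ≥0∞))]
    rfl
  simp_rw [h1]
  rw [lintegral_tsum fun i => (measurable_const.indicator (hQ i)).aemeasurable]
  refine tsum_congr fun i => ?_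
  rw [lintegral_indicator (hQ i)]
  simp

end Network

/-! ### The bound -/

lemma rotatedIntegral_nonneg (C g b : ℝ) : 0 ≤ rotatedIntegral C g b :=
  setIntegral_nonneg measurableSet_Ioi fun s hs => by
    have : 0 < s := hs
    positivity

/-- By the reflection formula and `sin (b π) = 2 sin (b π / 2) cos (b π / 2)`, the bound for the
expected number of received nodes is the stated constant times the expected number of neighbors
(both without their common factor `lam`). -/
lemma reception_constant_eq {lam p α θ γ δ : ℝ} (hlam : 0 < lam) (hp0 : 0 ≤ p)
    (hα : 2 < α) (hθ : 0 < θ) (hγ : 0 < γ) (hδ : 0 < δ) :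
    1 / Real.pi * (p * (1 - p)) * (θ / δ) ^ (2 / α) * Real.sin ((2 / α) * Real.pi / 2) *
        Real.Gamma (1 - 2 / α) * (∫ w : ℝ, alohaIntegrand lam p γ (2 / α) w).re *
      (Real.pi * θ ^ (-(2 / α)) * ((2 / α) * Real.Gamma (2 / α))) =
    p * (1 - p) * (Real.pi * (2 / α) * δ ^ (-(2 / α)) * rotatedIntegral
          (lam * p * ((2 / α) * Real.pi ^ 2 / Real.sin ((2 / α) * Real.pi))) (1 / γ) (2 / α)) := by
  have hα0 : 0 < α := by linarith
  have hb1 : 2 / α < 1 := (div_lt_one hα0).mpr hα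
  have hb0 : 0 < 2 / α := by positivity
  rcases hp0.eq_or_lt with rfl | hp
  · simp
  rw [re_integral_alohaIntegrand hlam hp hγ hb0 hb1]
  generalize rotatedIntegral _ _ _ = I
  generalize 2 / α = b at hb0 hb1 ⊢
  have hG := Real.Gamma_mul_Gamma_one_sub b
  rw [mul_comm Real.pi b] at hG
  have hs : 0 < Real.sin (b * Real.pi) := Real.sin_pos_of_pos_of_lt_pi (by positivity)
    (by nlinarith [Real.pi_pos])
  have h2 : Real.sin (b * Real.pi) =
      2 * Real.sin (b * Real.pi / 2) * Real.cos (b * Real.pi / 2) := by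
    rw [← Real.sin_two_mul]; congr 1; ring
  rw [Real.div_rpow hθ.le hδ.le, Real.rpow_neg hθ.le, Real.rpow_neg hδ.le]
  have h3 : 0 < θ ^ b := by positivity
  have h4 : 0 < δ ^ b := by positivity
  have h5 : 2 * Real.sin (b * Real.pi / 2) * Real.cos (b * Real.pi / 2) *
      (Real.Gamma b * Real.Gamma (1 - b)) = Real.pi := by
    rw [hG, ← h2]; field_simp
  have e1 : θ ^ b * (θ ^ b)⁻¹ = 1 := mul_inv_cancel₀ h3.ne'
  have e2 : 1 / Real.pi * Real.pi = 1 := by field_simp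
  calc _ = (1 / Real.pi * Real.pi) * (θ ^ b * (θ ^ b)⁻¹) * (p * (1 - p)) / δ ^ b * b * I *
      (2 * Real.sin (b * Real.pi / 2) * Real.cos (b * Real.pi / 2) *
      (Real.Gamma b * Real.Gamma (1 - b))) := by ring
    _ = _ := by rw [h5, e1, e2]; ring

end

theorem proposition1 {Ω : Type*} [MeasurableSpace Ω] (P : Measure Ω) [IsProbabilityMeasure P]
    (W : Network Ω) (lam p α θ γ δ b : ℝ)
    (hlam : 0 < lam) (hp0 : 0 ≤ p) (hp1 : p ≤ 1) (hα : 2 < α) (hθ : 0 < θ) (hγ : 0 < γ)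
    (hδ : 0 < δ) (hb : b = 2 / α)
    (hW : W.IsPoissonAloha P lam p)
    -- `L` bits per frame, `s` symbols per frame, `Mf` frames within `Ma` symbols
    (L Ma Mf : ℕ) (s : ℝ) (hL : 0 < L) (hs : (L : ℝ) / Real.logb 2 (1 + δ) ≤ s)
    (hMf : (Mf : ℝ) * s ≤ (Ma : ℝ)) :
    (0 < p → Integrable (alohaIntegrand lam p γ b)) ∧
    (∫ w : ℝ, alohaIntegrand lam p γ b w).im = 0 ∧
    (max 0 (1 - 1 / Real.pi * (p * (1 - p)) * (θ / δ) ^ b * Real.sin (b * Real.pi / 2) *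
        Real.Gamma (1 - b) * (∫ w : ℝ, alohaIntegrand lam p γ b w).re)) ^
          ((Ma : ℝ) * Real.logb 2 (1 + δ) / (L : ℝ))
      ≤ W.errorProb P α θ γ δ Mf := by
  have hα0 : 0 < α := by linarith
  subst hb
  have hb1 : 2 / α < 1 := (div_lt_one hα0).mpr hα
  have hb0 : 0 < 2 / α := by positivity
  refine ⟨fun hp => integrable_alohaIntegrand hlam hp hγ hb0 hb1,
    im_integral_alohaIntegrand _ _ _ _ hb1.ne, ?_⟩
  have hconst := reception_constant_eq hlam hp0 hα hθ hγ hδ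
  set c : ℝ := 1 / Real.pi * (p * (1 - p)) * (θ / δ) ^ (2 / α) *
    Real.sin ((2 / α) * Real.pi / 2) * Real.Gamma (1 - 2 / α) *
    (∫ w : ℝ, alohaIntegrand lam p γ (2 / α) w).re with hc
  have hG := Real.Gamma_pos_of_pos hb0
  have hrot := rotatedIntegral_nonneg
    (lam * p * ((2 / α) * Real.pi ^ 2 / Real.sin ((2 / α) * Real.pi))) (1 / γ) (2 / α)
  have hpp : 0 ≤ p * (1 - p) := mul_nonneg hp0 (by linarith)
  have hm0 : 0 < Real.pi * θ ^ (-(2 / α)) * ((2 / α) * Real.Gamma (2 / α)) := by positivity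
  have hc0 : 0 ≤ c := by
    refine nonneg_of_mul_nonneg_left ?_ hm0
    rw [hconst]
    positivity
  -- the expected number of neighbors is positive and finite
  obtain ⟨M, hM⟩ : ∃ M, ∑' i, P {ω | W.IsNeighbor α θ i ω} = M := ⟨_, rfl⟩
  have hMeq := hW.tsum_measure_isNeighbor hα0 hθ
  rw [hM] at hMeq
  have hMtop : M ≠ ∞ := by
    rw [hMeq]; exact ENNReal.mul_ne_top ENNReal.ofReal_ne_top ENNReal.ofReal_ne_top
  have hM0 : M ≠ 0 := by
    rw [hMeq]
    exact mul_ne_zero (ENNReal.ofReal_pos.mpr hlam).ne' (ENNReal.ofReal_pos.mpr hm0).ne'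
  have hle : ∑' i, ∫⁻ ω, W.receptionProb P α γ δ i
      ((fun j => W.pos j ω), (fun j => W.fade j ω)) ∂P ≤ ENNReal.ofReal c * M := by
    refine (hW.tsum_lintegral_receptionProb_le hlam hp0 hp1 hα hγ hδ).trans (le_of_eq ?_)
    rw [hMeq, mul_left_comm, ← ENNReal.ofReal_mul hc0, hconst, ENNReal.ofReal_mul hpp]
    ring
  have hjensen := pow_mul_le_tsum_lintegral (N := fun i => {ω | W.IsNeighbor α θ i ω})
    (r := fun i ω => W.receptionProb P α γ δ i ((fun j => W.pos j ω), (fun j => W.fade j ω)))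
    (fun i => (hW.measurable_receptionProb α γ δ i).comp hW.measurable_pos_fade)
    (fun i ω => hW.receptionProb_le_one α γ δ i _) hM hMtop hc0 hle Mf
  simp_rw [← hW.measure_isNeighbor_and_fails α θ γ δ _ Mf] at hjensen
  have hnbr := fun i =>
    Network.measurableSet_isNeighbor hW.measurable_pos hW.measurable_fade α θ i
  have hfail : ∀ i, MeasurableSet {ω | W.IsNeighbor α θ i ω ∧ W.Fails α γ δ Mf i ω} := by
    intro i
    refine (hnbr i).inter (MeasurableSet.congr (s := ⋂ m, ⋂ (_ : m < Mf),
      {ω | W.Receives α γ δ i m ω}ᶜ) ?_ (by ext ω; simp; rfl))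
    exact MeasurableSet.iInter fun m => MeasurableSet.iInter fun _ =>
      (Network.measurableSet_receives hW.measurable_pos hW.measurable_fade hW.measurable_tx
        α γ δ i m).compl
  have herr : max 0 (1 - c) ^ Mf ≤ W.errorProb P α θ γ δ Mf := by
    unfold Network.errorProb
    rw [Network.lintegral_encard_eq_tsum hnbr, Network.lintegral_encard_eq_tsum hfail, hM]
    have hnum : ∑' i, P {ω | W.IsNeighbor α θ i ω ∧ W.Fails α γ δ Mf i ω} ≤ M := by
      rw [← hM]
      exact ENNReal.tsum_le_tsum fun i => measure_mono fun ω h => h.1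
    refine (ENNReal.ofReal_le_iff_le_toReal (ENNReal.div_ne_top
      (hnum.trans_lt hMtop.lt_top).ne hM0)).mp ?_
    exact (ENNReal.le_div_iff_mul_le (Or.inl hM0) (Or.inl hMtop)).mpr hjensen
  refine le_trans ?_ herr
  -- the number of frames is at most `n_a`, and the base of the power is at most one
  have hlog : 0 < Real.logb 2 (1 + δ) := Real.logb_pos (by norm_num) (by linarith)
  have hLpos : (0 : ℝ) < L := by exact_mod_cast hL
  have hframes : (Mf : ℝ) ≤ (Ma : ℝ) * Real.logb 2 (1 + δ) / (L : ℝ) := by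
    rw [le_div_iff₀ hLpos]
    have h1 : (Mf : ℝ) * (L / Real.logb 2 (1 + δ)) ≤ Ma :=
      (mul_le_mul_of_nonneg_left hs (Nat.cast_nonneg _)).trans hMf
    rwa [← mul_div_assoc, div_le_iff₀ hlog] at h1
  rw [← Real.rpow_natCast]
  exact Real.rpow_le_rpow_of_exponent_ge' (le_max_left _ _)
    (max_le zero_le_one (by linarith)) (Nat.cast_nonneg _) hframes
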